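/- Let $p$ be a prime, let $G$ be a finite group with a Sylow $p$-subgroup $P$, and assume that $G$ has a normal $p$-complement $K$ (a normal subgroup of order prime to $p$ and of $p$-power index). Let $F$ be the residue field of a valuation ring $\mathcal{O}\subset\mathbb{C}$ of $\mathbb{C}$ with $\operatorname{char}F=p$ (so $F$ is algebraically closed), and let $\operatorname{IBr}_p(G)$ be the set of irreducible $p$-Brauer characters of $G$, formed with respect to $\mathcal{O}\to F$. Let $\varphi\in\operatorname{IBr}_p(G)$, let $V$ be the irreducible $FG$-module affording $\varphi$, and put $$\varphi^{\mathrm{Fix}(P)}(1)=\dim_F\{v\in V\mid vx=v\ \text{for all}\ x\in P\}.$$ Let $\Phi_\varphi$ be the complex character of the projective indecomposable $FG$-module with head $V$ (that is, the character of a projective $\mathcal{O}G$-lattice whose reduction is this module), and let $\chi\in\operatorname{Irr}(K)$ be a Fong character associated to $\varphi$, that is, an irreducible complex character of $K$ whose induced character satisfies $\chi^G=\Phi_\varphi$. Then $$\varphi^{\mathrm{Fix}(P)}(1)=\varphi(1)_{p'}$$ if and only if the inertia group $\mathrm{I}_P(\chi)=\{x\in P\mid \chi(xkx^{-1})=\chi(k)\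 \text{for all}\ k\in K\}$ acts trivially by conjugation on $K/\operatorname{Ker}\chi$, where $\operatorname{Ker}\chi=\{k\in K\mid\chi(k)=\chi(1)\}$ and $n_{p'}$ denotes the largest divisor of $n$ prime to $p$. -/

import Mathlib

open Polynomial
open scoped MonoidAlgebra

noncomputable section

/-! ### Matrix representations -/

/-- The representation on column vectors `Rⁿ` given by a matrix representation. -/
def matRep {R G : Type*} [CommRing R] [Group G] {n : ℕ} (X : G →* Matrix (Fin n) (Fin n) R) :
    Representation R G (Fin n → R) :=
  (Matrix.toLinAlgEquiv' : Matrix (Fin n) (Fin n) R ≃ₐ[R] _).toMonoidHom.comp X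

/-- Entrywise change of scalars of a matrix representation along a ring homomorphism. -/
def mapMatRep {R S G : Type*} [CommRing R] [CommRing S] [Group G] {n : ℕ} (f : R →+* S)
    (X : G →* Matrix (Fin n) (Fin n) R) : G →* Matrix (Fin n) (Fin n) S :=
  (f.mapMatrix : Matrix (Fin n) (Fin n) R →+* Matrix (Fin n) (Fin n) S).toMonoidHom.comp X

/-! ### Ordinary irreducible characters -/

/-- `Irr K`: the irreducible complex characters of the group `K`, as functions `K → ℂ`. -/
structure Irr (K : Type*) [Group K] where
  toFun : K → ℂ
  exists_rep : ∃ (n : ℕ) (X : K →* Matrix (Fin n) (Fin n) ℂ),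
    (matRep X).IsIrreducible ∧ ∀ k, toFun k = (X k).trace

instance (K : Type*) [Group K] : CoeFun (Irr K) (fun _ => K → ℂ) := ⟨Irr.toFun⟩

/-- A complex matrix of finite order whose trace is its size is the identity. -/
theorem eq_one_of_trace_eq {n m : ℕ} (hm : m ≠ 0) (A : Matrix (Fin n) (Fin n) ℂ)
    (hA : A ^ m = 1) (ht : A.trace = n) : A = 1 := by
  classical
  rcases Nat.eq_zero_or_pos n with hn | hn
  · subst hn
    exact Subsingleton.elim _ _
  have : Nonempty (Fin n) := ⟨⟨0, hn⟩⟩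
  have hcard : A.charpoly.roots.card = n := by
    rw [← (IsAlgClosed.splits A.charpoly).natDegree_eq_card_roots, Matrix.charpoly_natDegree_eq_dim,
      Fintype.card_fin]
  have hnorm : ∀ z ∈ A.charpoly.roots, ‖z‖ = 1 := by
    intro z hz
    have h1 : z ∈ spectrum ℂ A :=
      Matrix.mem_spectrum_iff_isRoot_charpoly.2 (Polynomial.isRoot_of_mem_roots hz)
    have h2 := spectrum.pow_mem_pow A m h1
    rw [hA, spectrum.one_eq, Set.mem_singleton_iff] at h2
    exact Complex.norm_eq_one_of_pow_eq_one h2 hm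
  have hsum : A.charpoly.roots.sum = n := by
    rw [← Matrix.trace_eq_sum_roots_charpoly, ht]
  have hre : (A.charpoly.roots.map (fun z : ℂ => 1 - z.re)).sum = 0 := by
    have h3 : (A.charpoly.roots.map (fun z : ℂ => z.re)).sum = n := by
      have := congrArg Complex.reAddGroupHom hsum
      rw [map_multiset_sum] at this
      simpa using this
    rw [Multiset.sum_map_sub, h3]
    simp [hcard]
  have hone : ∀ z ∈ A.charpoly.roots, z = 1 := by
    intro z hz
    have hnn : ∀ x ∈ A.charpoly.roots.map (fun z : ℂ => 1 - z.re), (0 : ℝ) ≤ x := by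
      intro x hx
      obtain ⟨w, hw, rfl⟩ := Multiset.mem_map.1 hx
      have := (Complex.re_le_norm w).trans_eq (hnorm w hw)
      linarith
    have h4 : 1 - z.re = 0 :=
      Multiset.all_zero_of_le_zero_le_of_sum_eq_zero hnn hre _
        (Multiset.mem_map_of_mem (fun z : ℂ => 1 - z.re) hz)
    have h5 := hnorm z hz
    have h6 : z.re = ‖z‖ := by linarith
    have h7 : (‖z‖ : ℂ) = z := by
      have h8 : z.im = 0 := by
        have := Complex.sq_norm_sub_sq_re z
        rw [h6] at this
        nlinarith
      apply Complex.ext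
      · simp [h6]
      · simp [h8]
    rw [← h7, h5]
    simp
  have hpoly : A.charpoly = (X - C 1) ^ n := by
    have := (IsAlgClosed.splits A.charpoly).eq_prod_roots_of_monic (Matrix.charpoly_monic A)
    rw [Multiset.eq_replicate.2 ⟨hcard, hone⟩] at this
    simpa using this
  have hnil : (A - 1) ^ n = 0 := by
    have := Matrix.aeval_self_charpoly A
    rw [hpoly] at this
    simpa using this
  set S : ℂ[X] := ∑ i ∈ Finset.range m, X ^ i with hS
  have hgeom : S * (X - 1) = X ^ m - 1 := geom_sum_mul X m
  have hcop : IsCoprime ((X - C 1) ^ n) S := by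
    apply IsCoprime.pow_left
    rw [Irreducible.coprime_iff_not_dvd (Polynomial.irreducible_X_sub_C 1)]
    rw [Polynomial.dvd_iff_isRoot]
    simp [hS, Polynomial.IsRoot, Polynomial.eval_finsetSum, hm]
  obtain ⟨a, b, hab⟩ := hcop
  have h1 : X - 1 = a * (X - C 1) ^ n * (X - 1) + b * (X ^ m - 1) := by
    rw [← hgeom]
    calc X - 1 = (a * (X - C 1) ^ n + b * S) * (X - 1) := by rw [hab, one_mul]
      _ = _ := by ring
  have h2 := congrArg (Polynomial.aeval A) h1
  have h3 : A - 1 = 0 := by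
    simpa [hnil, hA] using h2
  exact sub_eq_zero.1 h3

/-- If `X` affords `χ`, then `χ k = χ 1` exactly when `X k = 1`. -/
theorem Irr.apply_eq_apply_one_iff {K : Type*} [Group K] [Finite K] (χ : Irr K) {n : ℕ}
    {X : K →* Matrix (Fin n) (Fin n) ℂ} (hX : ∀ k, χ k = (X k).trace) (k : K) :
    χ k = χ 1 ↔ X k = 1 := by
  have h1 : χ 1 = n := by rw [hX, map_one, Matrix.trace_one, Fintype.card_fin]
  constructor
  · intro h
    refine eq_one_of_trace_eq (m := Nat.card K) Nat.card_pos.ne' _ ?_ ?_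
    · rw [← map_pow, pow_card_eq_one', map_one]
    · rw [← hX, h, h1]
  · intro h
    rw [hX, h, h1, Matrix.trace_one, Fintype.card_fin]

/-- `Ker χ = {k ∈ K | χ(k) = χ(1)}`, a normal subgroup of `K`. -/
def Irr.ker {K : Type*} [Group K] [Finite K] (χ : Irr K) : Subgroup K where
  carrier := {k | χ k = χ 1}
  one_mem' := rfl
  mul_mem' := by
    obtain ⟨n, X, -, hX⟩ := χ.exists_rep
    intro a b ha hb
    rw [Set.mem_ofPred_eq, χ.apply_eq_apply_one_iff hX] at ha hb ⊢
    rw [map_mul, ha, hb, one_mul]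
  inv_mem' := by
    obtain ⟨n, X, -, hX⟩ := χ.exists_rep
    intro a ha
    rw [Set.mem_ofPred_eq, χ.apply_eq_apply_one_iff hX] at ha ⊢
    have h : X a⁻¹ * X a = 1 := by rw [← map_mul, inv_mul_cancel, map_one]
    rwa [ha, mul_one] at h

/-- The character of `G` induced from a function `χ` on the subgroup `K`:
`χ^G(g) = |K|⁻¹ ∑_{x ∈ G, x⁻¹ g x ∈ K} χ(x⁻¹ g x)`. -/
def inducedCharacter {G : Type*} [Group G] [Finite G] (K : Subgroup G) (χ : K → ℂ) (g : G) : ℂ :=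
  letI := Fintype.ofFinite G
  letI := Classical.dec
  (Nat.card K : ℂ)⁻¹ * ∑ x : G, if h : x⁻¹ * g * x ∈ K then χ ⟨x⁻¹ * g * x, h⟩ else 0

/-- The inertia group `I_P(χ)`: all `x ∈ P` with `χ(x k x⁻¹) = χ(k)` for all `k` in the normal
subgroup `K`. -/
def inertiaGroup {G : Type*} [Group G] (K : Subgroup G) [K.Normal] (P : Subgroup G)
    (χ : K → ℂ) : Subgroup G where
  carrier := {x | x ∈ P ∧ ∀ k, χ (MulAut.conjNormal x k) = χ k}
  one_mem' := ⟨P.one_mem, fun k => by simp⟩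
  mul_mem' := fun {a b} ha hb => ⟨P.mul_mem ha.1 hb.1, fun k => by
    rw [map_mul, MulAut.mul_apply, ha.2, hb.2]⟩
  inv_mem' := fun {a} ha => ⟨P.inv_mem ha.1, fun k => by
    rw [← ha.2, ← MulAut.mul_apply, ← map_mul, mul_inv_cancel, map_one, MulAut.one_apply]⟩

/-! ### Brauer characters

We use a `p`-modular system inside `ℂ`: a valuation ring `O` of `ℂ` whose residue field
`F = O / 𝔪` has characteristic `p`. Since `ℂ` is algebraically closed, so is `F`. -/

open IsLocalRing (ResidueField residue)

/-- Any two roots of unity of order prime to `p` in `O` with the same residue are equal. -/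
theorem rootOfUnity_residue_injective (p : ℕ) [Fact p.Prime] (O : ValuationSubring ℂ)
    [CharP (ResidueField O) p] {z w : O} {m l : ℕ} (hm : ¬ p ∣ m) (hl : ¬ p ∣ l)
    (hz : z ^ m = 1) (hw : w ^ l = 1) (h : residue O z = residue O w) : z = w := by
  have hml : ¬ p ∣ m * l := fun h => ((Fact.out : p.Prime).dvd_mul.1 h).elim hm hl
  obtain ⟨N, hN⟩ : ∃ N, m * l = N + 1 :=
    Nat.exists_eq_succ_of_ne_zero (fun h0 => hml (h0 ▸ dvd_zero p))
  have hw' : w ^ N * w = 1 := by rw [← pow_succ, ← hN, mul_comm, pow_mul, hw, one_pow]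
  have hu : (z * w ^ N) ^ (m * l) = 1 := by
    rw [mul_pow, pow_mul, hz, one_pow, one_mul, ← pow_mul, mul_comm N, mul_comm m, mul_assoc,
      pow_mul, hw, one_pow]
  have hr : residue O (z * w ^ N) = 1 := by
    rw [map_mul, h, ← map_mul, mul_comm, hw', map_one]
  have h1 : z * w ^ N = 1 := by
    by_contra hne
    have h0 : (∑ i ∈ Finset.range (m * l), (z * w ^ N) ^ i) = 0 := by
      have := geom_sum_mul (z * w ^ N) (m * l)
      rw [hu, sub_self] at this
      exact (mul_eq_zero.1 this).resolve_right (sub_ne_zero.2 hne)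
    have h2 := congrArg (residue O) h0
    rw [map_sum, map_zero] at h2
    simp only [map_pow, hr, one_pow, Finset.sum_const, Finset.card_range, nsmul_eq_mul,
      mul_one] at h2
    exact hml ((CharP.cast_eq_zero_iff (ResidueField O) p _).1 h2)
  calc z = z * (w ^ N * w) := by rw [hw', mul_one]
    _ = w := by rw [← mul_assoc, h1, one_mul]

/-- Every root of unity of order prime to `p` in `F` is the residue of one in `O`. -/
theorem exists_rootOfUnity_residue_eq (p : ℕ) [Fact p.Prime] (O : ValuationSubring ℂ)
    {m : ℕ} (hm : ¬ p ∣ m) {c : ResidueField O} (hc : c ^ m = 1) :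
    ∃ z : O, z ^ m = 1 ∧ residue O z = c := by
  have hm0 : m ≠ 0 := fun h => hm (h ▸ dvd_zero p)
  have hζ := Complex.isPrimitiveRoot_exp m hm0
  set ζ := Complex.exp (2 * Real.pi * Complex.I / m)
  have hmem : ζ ∈ O := by
    rcases O.mem_or_inv_mem ζ with h | h
    · exact h
    · have h2 : ζ = ζ⁻¹ ^ (m - 1) := by
        have h3 : ζ * ζ ^ (m - 1) = 1 := by
          rw [← pow_succ', Nat.sub_add_cancel (Nat.pos_of_ne_zero hm0), hζ.pow_eq_one]
        rw [inv_pow]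
        exact eq_inv_of_mul_eq_one_left h3
      rw [h2]
      exact pow_mem h _
  have hξ : IsPrimitiveRoot (⟨ζ, hmem⟩ : O) m :=
    IsPrimitiveRoot.of_map_of_injective (f := O.subtype) (by simpa using hζ)
      Subtype.val_injective
  have hprod := X_pow_sub_one_eq_prod (Nat.pos_of_ne_zero hm0) hξ
  have h1 := congrArg (fun q => Polynomial.eval c (q.map (residue O))) hprod
  simp only [Polynomial.map_sub, Polynomial.map_pow, Polynomial.map_X, Polynomial.map_one,
    Polynomial.eval_sub, Polynomial.eval_pow, Polynomial.eval_X, Polynomial.eval_one, hc,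
    sub_self, Polynomial.map_prod, Polynomial.eval_prod, Polynomial.map_C,
    Polynomial.eval_C] at h1
  obtain ⟨z, hz, hz0⟩ := Finset.prod_eq_zero_iff.1 h1.symm
  exact ⟨z, (Polynomial.mem_nthRootsFinset (Nat.pos_of_ne_zero hm0) 1).1 hz,
    (sub_eq_zero.1 hz0).symm⟩

open Classical in
/-- The lift of a root of unity `c ∈ F` of order prime to `p` to the root of unity in `O ⊆ ℂ` of
order prime to `p` with residue `c`; the value is `0` if `c` is no such root of unity. -/
def rootLift (p : ℕ) (O : ValuationSubring ℂ) (c : ResidueField O) : ℂ :=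
  if h : ∃ z : O, (∃ m : ℕ, ¬ p ∣ m ∧ z ^ m = 1) ∧ residue O z = c then (h.choose : ℂ) else 0

theorem rootLift_residue (p : ℕ) [Fact p.Prime] (O : ValuationSubring ℂ)
    [CharP (ResidueField O) p] {z : O} {m : ℕ} (hm : ¬ p ∣ m) (hz : z ^ m = 1) :
    rootLift p O (residue O z) = z := by
  have h : ∃ w : O, (∃ m : ℕ, ¬ p ∣ m ∧ w ^ m = 1) ∧ residue O w = residue O z :=
    ⟨z, ⟨m, hm, hz⟩, rfl⟩
  rw [rootLift, dif_pos h]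
  obtain ⟨⟨l, hl, hw⟩, hr⟩ := h.choose_spec
  exact congrArg Subtype.val (rootOfUnity_residue_injective p O hl hm hw hz hr)

/-- The `p`-regular elements of `G`: those of order prime to `p`. -/
abbrev PRegular (p : ℕ) (G : Type*) [Group G] : Type _ := {g : G // ¬ p ∣ orderOf g}

/-- The Brauer character of a matrix representation over `F`: at a `p`-regular element `g` it is
the sum of the lifts of the eigenvalues of `g`, counted with multiplicity. -/
def brauerCharacter (p : ℕ) (O : ValuationSubring ℂ) {G : Type*} [Group G] {n : ℕ}
    (X : G →* Matrix (Fin n) (Fin n) (ResidueField O)) (g : PRegular p G) : ℂ :=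
  ((X g.1).charpoly.roots.map (rootLift p O)).sum

/-- `IBr_p(G)`: the irreducible `p`-Brauer characters of `G`, as functions on the `p`-regular
elements of `G`. -/
structure IBr (p : ℕ) (O : ValuationSubring ℂ) (G : Type*) [Group G] where
  toFun : PRegular p G → ℂ
  exists_rep : ∃ (n : ℕ) (X : G →* Matrix (Fin n) (Fin n) (ResidueField O)),
    (matRep X).IsIrreducible ∧ brauerCharacter p O X = toFun

namespace IBr

variable {p : ℕ} {O : ValuationSubring ℂ} {G : Type*} [Group G]

/-- The degree `φ(1)`, which is the dimension of the module affording `φ` (see `toFun_one`). -/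
def degree (φ : IBr p O G) : ℕ := φ.exists_rep.choose

/-- The matrices of the irreducible `FG`-module affording `φ` (unique up to isomorphism). -/
def mat (φ : IBr p O G) : G →* Matrix (Fin φ.degree) (Fin φ.degree) (ResidueField O) :=
  φ.exists_rep.choose_spec.choose

/-- The irreducible representation over `F` affording `φ` (unique up to isomorphism). -/
def rep (φ : IBr p O G) : Representation (ResidueField O) G (Fin φ.degree → ResidueField O) :=
  matRep φ.mat

theorem rep_isIrreducible (φ : IBr p O G) : φ.rep.IsIrreducible :=
  φ.exists_rep.choose_spec.choose_spec.1

theorem brauerCharacter_mat (φ : IBr p O G) : brauerCharacter p O φ.mat = φ.toFun :=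
  φ.exists_rep.choose_spec.choose_spec.2

theorem toFun_one [Fact p.Prime] [CharP (ResidueField O) p] (φ : IBr p O G)
    (h : ¬ p ∣ orderOf (1 : G)) : φ.toFun ⟨1, h⟩ = φ.degree := by
  have h1 : rootLift p O 1 = 1 := by
    have := rootLift_residue p O (z := 1) (m := 1) (Fact.out : p.Prime).not_dvd_one (one_pow 1)
    simpa using this
  rw [← φ.brauerCharacter_mat]
  have h2 : (φ.mat 1).charpoly = (X - C 1) ^ φ.degree := by
    rw [map_one, Matrix.charpoly_one, Fintype.card_fin, Polynomial.C_1]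
  rw [brauerCharacter, h2, Polynomial.roots_pow, Polynomial.roots_X_sub_C]
  rw [Multiset.nsmul_singleton, Multiset.map_replicate, h1]
  simp

/-- `φ^{Fix(P)}(1)`: the dimension over `F` of the space of `P`-fixed points of the module
affording `φ`. -/
def fixDegree (φ : IBr p O G) (P : Subgroup G) : ℕ :=
  Module.finrank (ResidueField O) (Representation.invariants (φ.rep.comp P.subtype))

end IBr

/-! ### Projective indecomposable modules and Fong characters -/

/-- An indecomposable module: nonzero, and not the direct sum of two nonzero submodules. -/
def IsIndecomposableModule (R M : Type*) [Ring R] [AddCommGroup M] [Module R M] : Prop :=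
  Nontrivial M ∧ ∀ A B : Submodule R M, IsCompl A B → A = ⊥ ∨ B = ⊥

/-- The representation `ρ` over `F` is the projective indecomposable module whose head
(the quotient by the Jacobson radical) is the irreducible module affording `φ`. -/
structure IsPIM {p : ℕ} {O : ValuationSubring ℂ} {G : Type*} [Group G] (φ : IBr p O G)
    {V : Type*} [AddCommGroup V] [Module (ResidueField O) V]
    (ρ : Representation (ResidueField O) G V) : Prop where
  projective : Module.Projective (ResidueField O)[G] ρ.asModule
  indecomposable : IsIndecomposableModule (ResidueField O)[G] ρ.asModule
  head : Nonempty ((ρ.asModule ⧸ Module.jacobson (ResidueField O)[G] ρ.asModule)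
    ≃ₗ[(ResidueField O)[G]] φ.rep.asModule)

/-- `Ψ` is the complex character `Φ_φ` of the `φ`-PIM, that is, the character of a projective
`OG`-lattice whose reduction modulo the maximal ideal of `O` is the `φ`-PIM. -/
def IsPIMCharacter {p : ℕ} {O : ValuationSubring ℂ} {G : Type*} [Group G] (φ : IBr p O G)
    (Ψ : G → ℂ) : Prop :=
  ∃ (n : ℕ) (X : G →* Matrix (Fin n) (Fin n) O),
    Module.Projective O[G] (matRep X).asModule ∧
    IsPIM φ (matRep (mapMatRep (residue O) X)) ∧
    ∀ g, Ψ g = ((X g).trace : ℂ)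

/-- `χ ∈ Irr(K)` is a Fong character associated to `φ ∈ IBr_p(G)`: `χ^G = Φ_φ`. -/
def IsFongCharacter {p : ℕ} {O : ValuationSubring ℂ} {G : Type*} [Group G] [Finite G]
    (φ : IBr p O G) (K : Subgroup G) (χ : Irr K) : Prop :=
  IsPIMCharacter φ (inducedCharacter K χ)

/-- `K` is a `p`-complement of `G`: its order is prime to `p` and its index is a power of `p`. -/
def IsPComplement (p : ℕ) {G : Type*} [Group G] (K : Subgroup G) : Prop :=
  ¬ p ∣ Nat.card K ∧ ∃ a : ℕ, K.index = p ^ a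

/-- The elements of `H` act trivially by conjugation on the set `K / Ker χ` of cosets. -/
def ActsTriviallyOnQuotientKer {G : Type*} [Group G] [Finite G] (H : Subgroup G)
    (K : Subgroup G) [K.Normal] (χ : Irr K) : Prop :=
  ∀ x ∈ H, ∀ k : K, ((MulAut.conjNormal x k : K) : K ⧸ χ.ker) = (k : K ⧸ χ.ker)

end

/-! Write `d = χ(1)`, `I = I_P(χ)`, and let `V` be the module affording `φ`. The character `χ` is
afforded by a representation `Y` over `O`. All of Schur's lemma is packed into the identity `∑ Y(k)
A Y(k⁻¹) = c tr(A)` with `c d = |K|`. As `|K|` is prime to `p`, `c` is a unit and `p ∤ d`. The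
identity survives reduction, so the reduction `W` of `Y` is irreducible with scalar endomorphisms,
and `e = c⁻¹ ∑ tr(Y(k⁻¹)) k` is a central idempotent of `O[K]` acting as `1` on `Y`.

Restricted to `K`, `χ^G` is a sum of conjugates of `χ`. If `e` killed `V`, so would all its
conjugates, and `z = ∏ₓ (1 - eˣ)` would act as `1` on `V`. But `z` has trace zero on the lattice
affording `χ^G`, hence acts there as `0`, and so also on its quotient `V`. So `W` occurs in `V`
(`lift_centralIdempotent_ne_zero`).

Since `I` is a `p`-group and `F` is perfect, `W` carries a genuine action of `I` compatible with
conjugation (`exists_monoidHom_intertwining`). Then `I` acts on the nonzero space `Hom_K(W, V)` and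
fixes a nonzero vector there, which is an embedding of `W` onto a subspace `D` stable under `I` and
`K` (`exists_equivariant_embedding`).

As `G = PK`, the `P`-translates of `D` span `V`, while `e` is the identity on `D` and kills `xD` for
`x ∈ P \ I`. Hence `V` is the direct sum of the `xD` over `P/I`, so `φ(1) = |P : I| d` and
`φ(1)_{p'} = d`. The `P`-fixed points of `V` correspond to the `I`-fixed points of `D`, so they have
dimension `d` exactly when `I` is trivial on `D` (`finrank_of_imprimitive`).

If `I` is trivial on `D`, then `W(xkx⁻¹) = W(k)`. Conversely, that equality makes `x` act on `D` as
a scalar of `p`-power order, which is `1` in characteristic `p`. Finally `W` and `Y` have the same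
kernel `Ker χ`, because `|K|` is prime to `p`. -/

open IsLocalRing (ResidueField residue)

/-! ### Schur relations for matrix representations -/

/-- The Schur relations with constant `c` for a matrix representation. -/
def SchurOrthogonal {K R : Type*} [Group K] [Fintype K] [CommRing R] {d : ℕ}
    (W : K →* Matrix (Fin d) (Fin d) R) (c : R) : Prop :=
  ∀ A : Matrix (Fin d) (Fin d) R, ∑ k, W k * A * W k⁻¹ = (c * A.trace) • 1

theorem matRep_apply {R G : Type*} [CommRing R] [Group G] {n : ℕ}
    (X : G →* Matrix (Fin n) (Fin n) R) (g : G) (v : Fin n → R) :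
    matRep X g v = (X g).mulVec v := rfl

theorem mapMatRep_apply {R S G : Type*} [CommRing R] [CommRing S] [Group G] {n : ℕ} (f : R →+* S)
    (X : G →* Matrix (Fin n) (Fin n) R) (g : G) : mapMatRep f X g = (X g).map f := rfl

theorem eq_bot_or_eq_top_of_isIrreducible {R G V : Type*} [Field R] [Group G] [AddCommGroup V]
    [Module R V] {ρ : Representation R G V} (h : ρ.IsIrreducible) (S : Submodule R V)
    (hS : ∀ g, ∀ v ∈ S, ρ g v ∈ S) : S = ⊥ ∨ S = ⊤ := by
  rcases h.eq_bot_or_eq_top ⟨S, fun g v => hS g v⟩ with h | h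
  · exact Or.inl (congrArg Subrepresentation.toSubmodule h)
  · exact Or.inr (congrArg Subrepresentation.toSubmodule h)

theorem nontrivial_of_isIrreducible {R G V : Type*} [Field R] [Group G] [AddCommGroup V]
    [Module R V] {ρ : Representation R G V} (h : ρ.IsIrreducible) : Nontrivial V := by
  by_contra hn
  rw [not_nontrivial_iff_subsingleton] at hn
  have := h.toNontrivial
  obtain ⟨a, b, hab⟩ := exists_pair_ne (Subrepresentation ρ)
  exact hab (Subrepresentation.toSubmodule_injective (Subsingleton.elim _ _))

section
variable {K : Type*} [Group K]

theorem eq_smul_one_of_commute {F : Type*} [Field F] [IsAlgClosed F] {d : ℕ}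
    {W : K →* Matrix (Fin d) (Fin d) F} (hW : (matRep W).IsIrreducible)
    (B : Matrix (Fin d) (Fin d) F) (hB : ∀ k, W k * B = B * W k) : ∃ a : F, B = a • 1 := by
  have : Nontrivial (Fin d → F) := nontrivial_of_isIrreducible hW
  obtain ⟨a, ha⟩ := Module.End.exists_eigenvalue (Matrix.toLin' B)
  refine ⟨a, ?_⟩
  rcases eq_bot_or_eq_top_of_isIrreducible hW (Module.End.eigenspace (Matrix.toLin' B) a) (by
    intro k v hv
    rw [Module.End.mem_eigenspace_iff] at hv ⊢
    rw [Matrix.toLin'_apply] at hv ⊢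
    rw [matRep_apply, Matrix.mulVec_mulVec, ← hB, ← Matrix.mulVec_mulVec, hv,
      Matrix.mulVec_smul]) with h | h
  · exact absurd h ha
  · apply Matrix.toLin'.injective
    ext1 i
    ext1
    have hv : (Pi.single i 1 : Fin d → F) ∈ Module.End.eigenspace (Matrix.toLin' B) a :=
      h ▸ Submodule.mem_top
    rw [Module.End.mem_eigenspace_iff] at hv
    simpa using hv

variable [Fintype K]

/-- Averaging a matrix over two representations gives an intertwiner. -/
theorem mul_sum_conj_eq {R : Type*} [CommRing R] {d e : ℕ}
    (W : K →* Matrix (Fin d) (Fin d) R) (W' : K →* Matrix (Fin e) (Fin e) R)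
    (A : Matrix (Fin d) (Fin e) R) (h : K) :
    W h * ∑ k, W k * A * W' k⁻¹ = (∑ k, W k * A * W' k⁻¹) * W' h := by
  rw [Matrix.mul_sum, Matrix.sum_mul]
  refine Fintype.sum_equiv (Equiv.mulLeft h) _ _ fun k => ?_
  simp only [Equiv.coe_mulLeft, mul_inv_rev, map_mul]
  rw [Matrix.mul_assoc _ _ (W' h), Matrix.mul_assoc (W' k⁻¹), ← map_mul W' h⁻¹ h]
  simp [Matrix.mul_assoc]

theorem schurOrthogonal_of_isIrreducible {F : Type*} [Field F] [IsAlgClosed F] [CharZero F] {d : ℕ}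
    {W : K →* Matrix (Fin d) (Fin d) F} (hW : (matRep W).IsIrreducible) :
    SchurOrthogonal W ((Fintype.card K : F) / d) := by
  have : Nontrivial (Fin d → F) := nontrivial_of_isIrreducible hW
  have hd : d ≠ 0 := by
    rintro rfl
    exact not_subsingleton (Fin 0 → F) inferInstance
  intro A
  obtain ⟨a, ha⟩ := eq_smul_one_of_commute hW _ (mul_sum_conj_eq W W A)
  rw [ha]
  congr 1
  have h1 := congrArg Matrix.trace ha
  have h2 : ∀ k, (W k * A * W k⁻¹).trace = A.trace := fun k => by
    rw [Matrix.trace_mul_comm, ← mul_assoc, ← map_mul, inv_mul_cancel, map_one, one_mul]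
  rw [Matrix.trace_sum, Finset.sum_congr rfl fun k _ => h2 k] at h1
  simp at h1
  field_simp
  rw [h1]

namespace SchurOrthogonal
variable {R : Type*} [CommRing R] {d : ℕ} {W : K →* Matrix (Fin d) (Fin d) R} {c : R}

/-- The defining identity at an elementary matrix: the classical orthogonality of matrix
coefficients. -/
theorem sum_entry (h : SchurOrthogonal W c) (i j l m : Fin d) :
    ∑ k, W k i j * W k⁻¹ l m = if i = m ∧ j = l then c else 0 := by
  have := congrFun (congrFun (h (Matrix.single j l 1)) i) m
  rw [Matrix.sum_apply] at this
  simp only [Matrix.smul_apply, Matrix.one_apply, smul_eq_mul] at this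
  rw [Finset.sum_congr rfl fun k _ => ?_, this]
  · by_cases h1 : i = m <;> by_cases h2 : j = l <;> simp [h1, h2, Matrix.trace_single_eq_of_ne]
  · simp [Matrix.mul_apply, Matrix.single_apply, ite_and]

theorem mul_degree (h : SchurOrthogonal W c) (hd : d ≠ 0) : c * d = Fintype.card K := by
  have h1 := congrFun (congrFun (h 1) ⟨0, Nat.pos_of_ne_zero hd⟩) ⟨0, Nat.pos_of_ne_zero hd⟩
  simp only [mul_one, ← map_mul, mul_inv_cancel, map_one, Finset.sum_const, Finset.card_univ,
    Matrix.smul_apply, Matrix.one_apply_eq, Matrix.trace_one, Fintype.card_fin, smul_eq_mul] at h1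
  rw [← h1]
  simp

theorem sum_trace_inv_smul (h : SchurOrthogonal W c) : ∑ k, (W k⁻¹).trace • W k = c • 1 := by
  ext i j
  rw [Matrix.sum_apply]
  simp only [Matrix.smul_apply, Matrix.trace, Matrix.diag, smul_eq_mul, Finset.sum_mul]
  rw [Finset.sum_comm, Finset.sum_congr rfl fun l _ =>
    (Finset.sum_congr rfl fun k _ => mul_comm _ _).trans (h.sum_entry i j l l)]
  by_cases hij : i = j
  · subst hij
    simp
  · simp only [Matrix.one_apply_ne hij, mul_zero]
    exact Finset.sum_eq_zero fun l _ => if_neg fun h => hij (h.1.trans h.2.symm)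

theorem comp_equiv (h : SchurOrthogonal W c) (σ : K ≃* K) :
    SchurOrthogonal (W.comp σ.toMonoidHom) c := by
  intro A
  rw [← h A]
  exact Fintype.sum_equiv σ.toEquiv _ _ fun k => by simp

/-- Surjectivity is needed because the relations quantify over all matrices, and each one over `S`
must lift to `R`. This is how irreducibility passes to the residue field. -/
theorem map {S : Type*} [CommRing S] (h : SchurOrthogonal W c) (f : R →+* S)
    (hf : Function.Surjective f) : SchurOrthogonal (mapMatRep f W) (f c) := by
  intro A
  obtain ⟨B, rfl⟩ : ∃ B : Matrix (Fin d) (Fin d) R, B.map f = A :=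
    ⟨A.map (Function.surjInv hf), by ext; simp [Function.surjInv_eq]⟩
  have := congrArg f.mapMatrix (h B)
  rw [map_sum] at this
  simp only [map_mul, RingHom.mapMatrix_apply] at this
  simp only [mapMatRep_apply]
  rw [this]
  ext i j
  simp [Matrix.one_apply, Matrix.trace, apply_ite f]

/-- Schur relations force irreducibility. -/
theorem eq_bot_or_eq_top {F : Type*} [Field F] {W : K →* Matrix (Fin d) (Fin d) F} {c : F}
    (h : SchurOrthogonal W c) (hc : c ≠ 0) (S : Submodule F (Fin d → F))
    (hS : ∀ k, ∀ v ∈ S, (W k).mulVec v ∈ S) : S = ⊥ ∨ S = ⊤ := by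
  by_cases hb : S = ⊥
  · exact Or.inl hb
  obtain ⟨v, hv, hv0⟩ := S.ne_bot_iff.1 hb
  obtain ⟨l, hl⟩ := Function.ne_iff.1 hv0
  refine Or.inr (Submodule.eq_top_iff'.2 fun w => ?_)
  rw [pi_eq_sum_univ w]
  refine S.sum_mem fun m _ => S.smul_mem _ ?_
  -- By orthogonality `∑ W(k⁻¹)ₗₘ W(k)` is `c` times the elementary matrix sending `eₗ` to `eₘ`, so
  -- the group algebra moves `v` to every standard basis vector.
  have hm : ∑ k, W k⁻¹ l m • (W k).mulVec v = (c * v l) • fun j => if m = j then 1 else 0 := by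
    ext i
    simp only [Finset.sum_apply, Pi.smul_apply, Matrix.mulVec, dotProduct, smul_eq_mul,
      Finset.mul_sum]
    rw [Finset.sum_comm]
    have : ∀ j, ∑ k, W k⁻¹ l m * (W k i j * v j) = (if i = m ∧ j = l then c else 0) * v j :=
      fun j => by
        rw [← h.sum_entry i j l m, Finset.sum_mul]
        exact Finset.sum_congr rfl fun k _ => by ring
    rw [Finset.sum_congr rfl fun j _ => this j]
    rcases eq_or_ne i m with rfl | him
    · simp
    · simp [him, him.symm]
  have h1 : (c * v l) • (fun j => if m = j then (1 : F) else 0) ∈ S := by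
    rw [← hm]
    exact S.sum_mem fun k _ => S.smul_mem _ (hS k v hv)
  exact (S.smul_mem_iff (mul_ne_zero hc hl)).1 h1

/-- Averaging a commuting `B` returns `|K| B`, while the relations make it scalar. No eigenvalue is
used, so `F` need not be algebraically closed. -/
theorem eq_smul_one {F : Type*} [Field F] {W : K →* Matrix (Fin d) (Fin d) F} {c : F}
    (h : SchurOrthogonal W c) (hK : (Fintype.card K : F) ≠ 0) (B : Matrix (Fin d) (Fin d) F)
    (hB : ∀ k, W k * B = B * W k) : ∃ a : F, B = a • 1 := by
  refine ⟨(Fintype.card K : F)⁻¹ * (c * B.trace), ?_⟩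
  rw [mul_smul, ← h B, Finset.sum_congr rfl fun k _ => show W k * B * W k⁻¹ = B by
    rw [hB, mul_assoc, ← map_mul, mul_inv_cancel, map_one, mul_one]]
  rw [Finset.sum_const, Finset.card_univ, ← Nat.cast_smul_eq_nsmul F, smul_smul,
    inv_mul_cancel₀ hK, one_smul]

end SchurOrthogonal

/-- A nonzero intertwiner between two matrix representations of the same degree satisfying Schur
relations is invertible. -/
theorem isUnit_of_intertwiner {F : Type*} [Field F] {d : ℕ} {W W' : K →* Matrix (Fin d) (Fin d) F}
    {c : F} (h : SchurOrthogonal W' c) (hc : c ≠ 0) (B : Matrix (Fin d) (Fin d) F)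
    (hB : ∀ k, W k * B = B * W' k) (hB0 : B ≠ 0) : IsUnit B := by
  rw [← Matrix.mulVec_injective_iff_isUnit, ← Matrix.coe_mulVecLin, ← LinearMap.ker_eq_bot]
  refine (h.eq_bot_or_eq_top hc _ fun k v hv => ?_).resolve_right fun ht => hB0 ?_
  · rw [LinearMap.mem_ker, Matrix.mulVecLin_apply] at hv ⊢
    rw [Matrix.mulVec_mulVec, ← hB, ← Matrix.mulVec_mulVec, hv, Matrix.mulVec_zero]
  · rw [LinearMap.ker_eq_top] at ht
    exact Matrix.toLin'.injective (by rw [map_zero]; exact ht)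

/-- Two irreducible representations with equal traces are intertwined. -/
theorem exists_intertwiner {F : Type*} [Field F] {d : ℕ} {W W' : K →* Matrix (Fin d) (Fin d) F}
    {c : F} (h : SchurOrthogonal W' c) (hc : c ≠ 0) (hK : (Fintype.card K : F) ≠ 0) (hd : d ≠ 0)
    (htr : ∀ k, (W k).trace = (W' k).trace) :
    ∃ B : Matrix (Fin d) (Fin d) F, IsUnit B ∧ ∀ k, W k * B = B * W' k := by
  by_contra! hno
  -- If there is no invertible intertwiner, all averages vanish. Their diagonal entries give `∑ tr
  -- W(k) tr W'(k⁻¹) = 0`, whereas equality of traces makes this sum `c d = |K| ≠ 0`.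
  have h0 : ∀ A, ∑ k, W k * A * W' k⁻¹ = 0 := fun A => by
    by_contra hA
    obtain ⟨k, hk⟩ := hno _ (isUnit_of_intertwiner h hc _ (mul_sum_conj_eq W W' A) hA)
    exact hk (mul_sum_conj_eq W W' A k)
  have h1 : ∀ i l, ∑ k, W k i i * W' k⁻¹ l l = 0 := fun i l => by
    have := congrFun (congrFun (h0 (Matrix.single i l 1)) i) l
    rw [Matrix.sum_apply] at this
    rw [← Matrix.zero_apply (α := F) i l, ← this]
    exact Finset.sum_congr rfl fun k _ => by simp [Matrix.mul_apply, Matrix.single_apply, ite_and]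
  have h2 : ∑ k, (W k).trace * (W' k⁻¹).trace = 0 := by
    simp only [Matrix.trace, Matrix.diag, Finset.sum_mul_sum]
    rw [Finset.sum_comm]
    refine Finset.sum_eq_zero fun i _ => ?_
    rw [Finset.sum_comm]
    exact Finset.sum_eq_zero fun l _ => h1 i l
  have h3 := congrArg Matrix.trace h.sum_trace_inv_smul
  rw [Matrix.trace_sum] at h3
  simp only [Matrix.trace_smul, Matrix.trace_one, Fintype.card_fin, smul_eq_mul] at h3
  rw [h.mul_degree hd] at h3
  apply hK
  rw [← h3, ← h2]
  exact Finset.sum_congr rfl fun k _ => by rw [htr, mul_comm]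

/-- Representations over a field of characteristic zero with distinct traces have no intertwiners. -/
theorem sum_conj_eq_zero_of_trace_ne {F : Type*} [Field F] {d : ℕ}
    {W W' : K →* Matrix (Fin d) (Fin d) F}
    {c : F} (h : SchurOrthogonal W' c) (hc : c ≠ 0) {k : K} (htr : (W k).trace ≠ (W' k).trace)
    (A : Matrix (Fin d) (Fin d) F) : ∑ k, W k * A * W' k⁻¹ = 0 := by
  by_contra hA
  obtain ⟨B, hB⟩ := isUnit_of_intertwiner h hc _ (mul_sum_conj_eq W W' A) hA
  apply htr
  have h1 := mul_sum_conj_eq W W' A k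
  rw [← hB] at h1
  rw [(Units.eq_mul_inv_iff_mul_eq B).2 h1, Matrix.trace_mul_comm, ← mul_assoc, Units.inv_mul,
    one_mul]
end

/-! ### Integral forms over valuation rings -/

/-- A lattice over a valuation ring has a basis indexed by the dimension. -/
theorem exists_basis_of_isLattice {R L : Type*} [CommRing R] [IsDomain R] [ValuationRing R]
    [Field L] [Algebra R L] [IsFractionRing R L] {d : ℕ} (M : Submodule R (Fin d → L))
    [Submodule.IsLattice L M] : Nonempty (Module.Basis (Fin d) R M) := by
  have h1 : Module.IsTorsionFree R L := inferInstance
  have h2 : Module.IsTorsionFree R (Fin d → L) := inferInstance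
  have h3 : Module.IsTorsionFree R M := inferInstance
  have h4 : Module.Finite R M := Submodule.IsLattice.finite L M
  -- Over a valuation ring torsion-free means flat, and a finite flat module over a local ring is
  -- free.
  have h5 : Module.Flat R M := by
    rw [Module.Flat.flat_iff_torsion_eq_bot_of_isBezout]
    exact Submodule.isTorsionFree_iff_torsion_eq_bot.1 h3
  have h6 : Module.Free R M := Module.free_of_flat_of_isLocalRing
  let b := Module.Free.chooseBasis R M
  have e : Module.Free.ChooseBasisIndex R M ≃ Fin d :=
    (b.extendOfIsLattice L).indexEquiv (Pi.basisFun L (Fin d))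
  exact ⟨b.reindex e⟩

/-- A matrix representation of a finite group over the fraction field of a valuation ring is
equivalent to one with entries in the valuation ring. -/
theorem exists_integral_form {K : Type*} [Group K] [Finite K] {L : Type*} [Field L]
    (O : ValuationSubring L) {d : ℕ} (X : K →* Matrix (Fin d) (Fin d) L) :
    ∃ (Y : K →* Matrix (Fin d) (Fin d) O) (S : (Matrix (Fin d) (Fin d) L)ˣ),
      ∀ k, X k = S * (mapMatRep O.subtype Y k : Matrix (Fin d) (Fin d) L) * (S⁻¹ : _ˣ) := by
  -- The lattice spanned by all `K`-translates of the standard basis is `K`-stable and finitely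
  -- generated.
  let M : Submodule O (Fin d → L) :=
    Submodule.span O (Set.range fun q : K × Fin d => (X q.1).mulVec (Pi.single q.2 1))
  have hM : Submodule.IsLattice L M := by
    refine ⟨Submodule.fg_span (Set.finite_range _), eq_top_iff.2 ?_⟩
    rw [← (Pi.basisFun L (Fin d)).span_eq]
    refine Submodule.span_mono ?_
    rintro _ ⟨i, rfl⟩
    exact Submodule.subset_span ⟨(1, i), by simp only [map_one, Matrix.one_mulVec, Pi.basisFun_apply]⟩
  obtain ⟨b⟩ := exists_basis_of_isLattice M
  let b' := b.extendOfIsLattice L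
  have hb' : ∀ i, b' i = (b i : Fin d → L) := fun i => b.extendOfIsLattice_apply L i
  have hst : ∀ k, ∀ v ∈ M, ((matRep X k).restrictScalars O) v ∈ M := by
    intro k
    change M ≤ M.comap _
    rw [Submodule.span_le]
    rintro _ ⟨⟨h, i⟩, rfl⟩
    refine Submodule.subset_span ⟨(k * h, i), ?_⟩
    change _ = (X k).mulVec ((X h).mulVec (Pi.single i 1))
    rw [Matrix.mulVec_mulVec, ← map_mul]
  let ρ : Representation O K M :=
    { toFun := fun k => ((matRep X k).restrictScalars O).restrict (hst k)
      map_one' := by ext; simp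
      map_mul' := fun x y => by ext; simp }
  let Y : K →* Matrix (Fin d) (Fin d) O :=
    ((LinearMap.toMatrixAlgEquiv b : _ ≃ₐ[O] _) : (M →ₗ[O] M) →* Matrix (Fin d) (Fin d) O).comp ρ
  have hY : ∀ k, mapMatRep O.subtype Y k = LinearMap.toMatrix b' b' (matRep X k) := by
    intro k
    ext i j
    have h1 : ((ρ k (b j) : M) : Fin d → L) = ∑ i, (Y k i j : L) • b' i := by
      rw [← b.sum_repr (ρ k (b j))]
      simp only [hb', Submodule.coe_sum, Submodule.coe_smul]
      refine Finset.sum_congr rfl fun i _ => ?_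
      have : Y k i j = b.repr (ρ k (b j)) i := LinearMap.toMatrixAlgEquiv_apply b _ i j
      rw [this]
      rfl
    have h2 : matRep X k (b' j) = ((ρ k (b j) : M) : Fin d → L) := by rw [hb']; rfl
    rw [LinearMap.toMatrix_apply, h2, h1, map_sum, Finset.sum_apply']
    simp [Finsupp.single_apply, mapMatRep_apply]
  have hST := (Pi.basisFun L (Fin d)).toMatrix_mul_toMatrix_flip b'
  have hTS := b'.toMatrix_mul_toMatrix_flip (Pi.basisFun L (Fin d))
  refine ⟨Y, ⟨(Pi.basisFun L (Fin d)).toMatrix b', b'.toMatrix (Pi.basisFun L (Fin d)), hST, hTS⟩,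
    fun k => ?_⟩
  rw [hY]
  simp only [Units.inv_mk]
  rw [basis_toMatrix_mul_linearMap_toMatrix_mul_basis_toMatrix]
  have : matRep X k = Matrix.toLin' (X k) := rfl
  rw [this]
  exact (LinearMap.toMatrix'_toLin' (X k)).symm

/-! ### The central idempotent of an irreducible representation -/

section
variable {K : Type*} [Group K] [Fintype K] {R : Type*} [CommRing R] {d : ℕ}

/-- The element `c⁻¹ ∑ₖ tr(W(k⁻¹)) k` of the group algebra. -/
noncomputable def centralIdempotent (W : K →* Matrix (Fin d) (Fin d) R) (c : Rˣ) : R[K] :=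
  ∑ k, MonoidAlgebra.single k (((c⁻¹ : Rˣ) : R) * (W k⁻¹).trace)

theorem single_mul_centralIdempotent (W : K →* Matrix (Fin d) (Fin d) R) (c : Rˣ) (h : K) :
    MonoidAlgebra.single h 1 * centralIdempotent W c
      = ∑ k, MonoidAlgebra.single k (((c⁻¹ : Rˣ) : R) * (W k⁻¹ * W h).trace) := by
  rw [centralIdempotent, Finset.mul_sum]
  refine Fintype.sum_equiv (Equiv.mulLeft h) _ _ fun k => ?_
  rw [MonoidAlgebra.single_mul_single, one_mul, ← map_mul]
  simp [mul_assoc]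

theorem centralIdempotent_mul_single (W : K →* Matrix (Fin d) (Fin d) R) (c : Rˣ) (h : K) :
    centralIdempotent W c * MonoidAlgebra.single h 1
      = MonoidAlgebra.single h 1 * centralIdempotent W c := by
  rw [single_mul_centralIdempotent, centralIdempotent, Finset.sum_mul]
  refine Fintype.sum_equiv (Equiv.mulRight h) _ _ fun k => ?_
  rw [MonoidAlgebra.single_mul_single, mul_one, Matrix.trace_mul_comm, ← map_mul]
  simp

theorem centralIdempotent_mem_center (W : K →* Matrix (Fin d) (Fin d) R) (c : Rˣ) :
    centralIdempotent W c ∈ Subring.center R[K] := by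
  rw [Subring.mem_center_iff]
  intro a
  induction a using MonoidAlgebra.induction_on with
  | of h => exact (centralIdempotent_mul_single W c h).symm
  | add a b ha hb => rw [add_mul, mul_add, ha, hb]
  | smul r a ha => rw [smul_mul_assoc, mul_smul_comm, ha]

theorem lift_centralIdempotent {A : Type*} [Ring A] [Algebra R A] (f : K →* A)
    (W : K →* Matrix (Fin d) (Fin d) R) (c : Rˣ) :
    MonoidAlgebra.lift R A K f (centralIdempotent W c)
      = ((c⁻¹ : Rˣ) : R) • ∑ k, (W k⁻¹).trace • f k := by
  rw [centralIdempotent, map_sum, Finset.smul_sum]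
  exact Finset.sum_congr rfl fun k _ => by rw [MonoidAlgebra.lift_single, mul_smul]

theorem SchurOrthogonal.lift_centralIdempotent {W : K →* Matrix (Fin d) (Fin d) R} {c : Rˣ}
    (h : SchurOrthogonal W (c : R)) :
    MonoidAlgebra.lift R _ K W (centralIdempotent W c) = 1 := by
  rw [_root_.lift_centralIdempotent, h.sum_trace_inv_smul, smul_smul, Units.inv_mul, one_smul]

theorem SchurOrthogonal.isIdempotentElem {W : K →* Matrix (Fin d) (Fin d) R} {c : Rˣ}
    (h : SchurOrthogonal W (c : R)) : IsIdempotentElem (centralIdempotent W c) := by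
  have h1 : centralIdempotent W c * centralIdempotent W c
      = ∑ h, (((c⁻¹ : Rˣ) : R) * (W h⁻¹).trace) • (MonoidAlgebra.single h 1 *
        centralIdempotent W c) := by
    conv_lhs => enter [1]; rw [centralIdempotent]
    rw [Finset.sum_mul]
    refine Finset.sum_congr rfl fun k _ => ?_
    rw [← smul_mul_assoc, MonoidAlgebra.smul_single, smul_eq_mul, mul_one]
  rw [IsIdempotentElem, h1]
  simp only [single_mul_centralIdempotent, Finset.smul_sum]
  rw [Finset.sum_comm, centralIdempotent]
  refine Finset.sum_congr rfl fun k _ => ?_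
  simp only [MonoidAlgebra.smul_single]
  rw [← Finset.sum_congr rfl fun x _ => MonoidAlgebra.singleAddHom_apply k _, ← map_sum,
    MonoidAlgebra.singleAddHom_apply]
  congr 1
  -- The coefficient of `k` in the square is a convolution of characters, evaluated by taking the
  -- trace of `W(k⁻¹) ∑ tr(W(x⁻¹)) W(x) = c W(k⁻¹)`.
  have h2 := congrArg (fun B => (W k⁻¹ * B).trace) h.sum_trace_inv_smul
  simp only [Matrix.mul_sum, Matrix.trace_sum, Matrix.mul_smul, Matrix.trace_smul, smul_eq_mul,
    mul_one] at h2
  calc _ = ((c⁻¹ : Rˣ) : R) * (((c⁻¹ : Rˣ) : R) * ∑ x, (W x⁻¹).trace * (W k⁻¹ * W x).trace) := by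
        rw [Finset.mul_sum, Finset.mul_sum]
        exact Finset.sum_congr rfl fun x _ => by ring
    _ = _ := by rw [h2, Units.inv_mul_cancel_left]

/-- Given central idempotents `e i`, there is an idempotent killed by every algebra homomorphism
that maps some `e i` to `1` and mapped to `1` by every algebra homomorphism that kills all `e i`. -/
theorem exists_complementary_idempotent {A ι : Type*} [Ring A] [Fintype ι] (e : ι → A)
    (hc : ∀ i, e i ∈ Subring.center A) (he : ∀ i, IsIdempotentElem (e i)) :
    ∃ z : A, IsIdempotentElem z ∧ (∀ i, (1 - e i) ∣ z) ∧
      ∀ {B : Type*} [Ring B] (f : A →+* B), (∀ i, f (e i) = 0) → f z = 1 := by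
  classical
  let e' : ι → Subring.center A := fun i => ⟨e i, hc i⟩
  have he' : ∀ i, IsIdempotentElem (1 - e' i) := fun i =>
    IsIdempotentElem.one_sub (Subtype.ext (he i))
  -- The product is formed in the center, where it makes sense without an ordering of the factors.
  refine ⟨(∏ i, (1 - e' i) : Subring.center A), ?_, fun i => ?_, fun f hf => ?_⟩
  · have : (∏ i, (1 - e' i)) * ∏ i, (1 - e' i) = ∏ i, (1 - e' i) := by
      rw [← Finset.prod_mul_distrib]
      exact Finset.prod_congr rfl fun i _ => he' i
    exact congrArg Subtype.val this
  · obtain ⟨y, hy⟩ := Finset.dvd_prod_of_mem (fun i => 1 - e' i) (Finset.mem_univ i)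
    exact ⟨y, congrArg Subtype.val hy⟩
  · refine Finset.prod_induction (fun i => 1 - e' i) (fun z : Subring.center A => f z = 1)
      (fun a b ha hb => ?_) (map_one f) (fun i _ => ?_)
    · rw [Subring.coe_mul, map_mul, ha, hb, one_mul]
    · have : ((1 - e' i : Subring.center A) : A) = 1 - e i := rfl
      rw [this, map_sub, map_one, hf, sub_zero]
end

/-! ### Transport of Schur relations between `ℂ`, `O` and the residue field -/

section
variable {K : Type*} [Group K] [Fintype K] {d : ℕ}

theorem SchurOrthogonal.conj {R : Type*} [CommRing R] {W W' : K →* Matrix (Fin d) (Fin d) R} {c : R}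
    (h : SchurOrthogonal W c) (S : (Matrix (Fin d) (Fin d) R)ˣ)
    (hS : ∀ k, W k = S * W' k * (S⁻¹ : _ˣ)) : SchurOrthogonal W' c := by
  intro A
  have hS' : ∀ k, W' k = (S⁻¹ : _ˣ) * W k * S := fun k => by
    rw [hS]
    simp [mul_assoc]
  have h1 := h (S * A * (S⁻¹ : _ˣ))
  have h2 : (S * A * (S⁻¹ : _ˣ) : Matrix (Fin d) (Fin d) R).trace = A.trace := by
    rw [Matrix.trace_mul_comm, ← mul_assoc, Units.inv_mul, one_mul]
  rw [h2] at h1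
  calc _ = (S⁻¹ : _ˣ) * (∑ k, W k * (S * A * (S⁻¹ : _ˣ)) * W k⁻¹) * S := by
        rw [Finset.mul_sum, Finset.sum_mul]
        exact Finset.sum_congr rfl fun k _ => by rw [hS', hS']; simp only [mul_assoc]
    _ = _ := by rw [h1]; simp

theorem SchurOrthogonal.of_map {R L : Type*} [CommRing R] [CommRing L] (f : R →+* L)
    (hf : Function.Injective f) {W : K →* Matrix (Fin d) (Fin d) R} {c : R}
    (h : SchurOrthogonal (mapMatRep f W) (f c)) : SchurOrthogonal W c := by
  intro A
  apply Matrix.map_injective hf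
  beta_reduce
  have h1 := h (A.map f)
  have h2 : (∑ k, W k * A * W k⁻¹).map f = f.mapMatrix (∑ k, W k * A * W k⁻¹) := rfl
  rw [h2, map_sum]
  simp only [map_mul, RingHom.mapMatrix_apply]
  simp only [mapMatRep_apply] at h1
  rw [h1]
  ext i j
  simp [Matrix.one_apply, Matrix.trace, apply_ite f]

theorem sum_trace_inv_smul_eq_zero {R : Type*} [CommRing R]
    {W W' : K →* Matrix (Fin d) (Fin d) R}
    (h : ∀ A : Matrix (Fin d) (Fin d) R, ∑ k, W k * A * W' k⁻¹ = 0) :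
    ∑ k, (W' k⁻¹).trace • W k = 0 := by
  ext i j
  rw [Matrix.sum_apply]
  simp only [Matrix.smul_apply, Matrix.trace, Matrix.diag, smul_eq_mul, Finset.sum_mul]
  rw [Finset.sum_comm]
  refine Finset.sum_eq_zero fun l _ => ?_
  have := congrFun (congrFun (h (Matrix.single j l 1)) i) l
  rw [Matrix.sum_apply] at this
  refine Eq.trans ?_ this
  exact Finset.sum_congr rfl fun k _ => by
    simp [Matrix.mul_apply, Matrix.single_apply, ite_and, mul_comm]

theorem map_sum_trace_inv_smul {R S : Type*} [CommRing R] [CommRing S] (f : R →+* S)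
    (W : K →* Matrix (Fin d) (Fin d) R) (σ : K → K) :
    (∑ k, (W k⁻¹).trace • W (σ k)).map f
      = ∑ k, (mapMatRep f W k⁻¹).trace • mapMatRep f W (σ k) := by
  ext i j
  simp [Matrix.sum_apply, mapMatRep_apply, Matrix.trace]

/-- An irreducible character of `K` is afforded by an integral matrix representation satisfying
Schur relations. -/
theorem Irr.exists_integral_rep (χ : Irr K) (O : ValuationSubring ℂ) :
    ∃ (d : ℕ) (Y : K →* Matrix (Fin d) (Fin d) O) (c : O), d ≠ 0 ∧ SchurOrthogonal Y c ∧
      SchurOrthogonal (mapMatRep O.subtype Y) (c : ℂ) ∧ ∀ k, χ k = ((Y k).trace : ℂ) := by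
  obtain ⟨d, X, hX, hχ⟩ := χ.exists_rep
  have hd : d ≠ 0 := by
    rintro rfl
    have := nontrivial_of_isIrreducible hX
    exact not_subsingleton (Fin 0 → ℂ) inferInstance
  obtain ⟨Y, S, hS⟩ := exists_integral_form O X
  have h1 := (schurOrthogonal_of_isIrreducible hX).conj S hS
  let o : Fin d := ⟨0, Nat.pos_of_ne_zero hd⟩
  -- The constant `|K| / d` lies in `O`, being an orthogonality sum of integral matrix entries.
  have h2 : ((∑ k, Y k o o * Y k⁻¹ o o : O) : ℂ) = (Fintype.card K : ℂ) / d := by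
    have := h1.sum_entry o o o o
    simp only [and_self, if_true] at this
    rw [← this]
    push_cast
    rfl
  rw [← h2] at h1
  refine ⟨d, Y, ∑ k, Y k o o * Y k⁻¹ o o, hd, ?_, h1, fun k => ?_⟩
  · exact SchurOrthogonal.of_map O.subtype Subtype.val_injective h1
  · rw [hχ, hS, Matrix.trace_mul_comm, ← mul_assoc, Units.inv_mul, one_mul, mapMatRep_apply]
    exact (AddMonoidHom.map_trace O.subtype.toAddMonoidHom (Y k)).symm

/-- The geometric sum `S = 1 + A + ⋯ + A^(m-1)` satisfies `S (A - 1) = 0` and reduces to the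
invertible scalar `m`, so `S` is invertible. Hence reduction loses no kernel in a group of order
prime to the residue characteristic. -/
theorem eq_one_of_residue_eq_one {R : Type*} [CommRing R] [IsLocalRing R]
    (A : Matrix (Fin d) (Fin d) R) {m : ℕ} (hm : IsUnit (m : R)) (hA : A ^ m = 1)
    (h : A.map (residue R) = 1) : A = 1 := by
  set S := ∑ i ∈ Finset.range m, A ^ i with hS
  have h1 : S * (A - 1) = 0 := by rw [hS, geom_sum_mul, hA, sub_self]
  have h2 : S.map (residue R) = (m : ResidueField R) • 1 := by
    have : S.map (residue R) = (residue R).mapMatrix S := rfl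
    rw [this, hS, map_sum]
    simp only [map_pow, RingHom.mapMatrix_apply, h, one_pow]
    simp [Nat.cast_smul_eq_nsmul]
  have h3 : IsUnit S.det := by
    rw [← IsLocalRing.residue_ne_zero_iff_isUnit, RingHom.map_det, RingHom.mapMatrix_apply, h2,
      Matrix.det_smul, Matrix.det_one, mul_one]
    refine pow_ne_zero _ ?_
    have := (IsLocalRing.residue_ne_zero_iff_isUnit _).2 hm
    rwa [map_natCast] at this
  exact sub_eq_zero.1 (((Matrix.isUnit_iff_isUnit_det S).2 h3).mul_right_eq_zero.1 h1)
end

/-! ### The idempotent of `χ` on quotients of a reduced lattice -/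

section
variable {R F : Type*} [CommRing R] [Field F] [Algebra R F] {G : Type*} [Group G]

theorem lift_mapMatRep {K : Type*} [Group K] {n : ℕ} (X : K →* Matrix (Fin n) (Fin n) R) (a : R[K]) :
    MonoidAlgebra.lift R _ K (mapMatRep (algebraMap R F) X) a
      = (MonoidAlgebra.lift R _ K X a).map (algebraMap R F) := by
  have : MonoidAlgebra.lift R _ K (mapMatRep (algebraMap R F) X)
      = ((Algebra.ofId R F).mapMatrix).comp (MonoidAlgebra.lift R _ K X) := by
    ext k : 2
    simp [mapMatRep_apply]
  rw [this]
  rfl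

theorem lift_mulVec_intertwine {K : Type*} [Group K] {n N : ℕ}
    (U : K →* Matrix (Fin n) (Fin n) F) (V : K →* Matrix (Fin N) (Fin N) F)
    (π : (Fin n → F) →ₗ[F] (Fin N → F)) (hπ : ∀ k u, π ((U k).mulVec u) = (V k).mulVec (π u))
    (a : R[K]) (u : Fin n → F) :
    π ((MonoidAlgebra.lift R _ K U a).mulVec u) = (MonoidAlgebra.lift R _ K V a).mulVec (π u) := by
  induction a using MonoidAlgebra.induction_on with
  | of h => simpa using hπ h u
  | add a b ha hb => simp only [map_add, Matrix.add_mulVec, ha, hb]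
  | smul r a ha =>
    simp only [map_smul]
    rw [← algebraMap_smul F r, ← algebraMap_smul F r, Matrix.smul_mulVec, Matrix.smul_mulVec,
      map_smul, ha]

/-- Over the fraction field the trace of an idempotent is its rank, which characteristic zero
detects. -/
theorem matrix_eq_zero_of_isIdempotentElem [IsDomain R] [CharZero R] {n : ℕ}
    {B : Matrix (Fin n) (Fin n) R} (hB : IsIdempotentElem B) (ht : B.trace = 0) : B = 0 := by
  let L := FractionRing R
  have hinj : Function.Injective (algebraMap R L) := IsFractionRing.injective R L
  have : CharZero L := charZero_of_injective_algebraMap hinj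
  have h1 : IsIdempotentElem (Matrix.toLin' (B.map (algebraMap R L))) := by
    rw [IsIdempotentElem, Module.End.mul_eq_comp, ← Matrix.toLin'_mul, ← Matrix.map_mul, hB.eq]
  have h2 := LinearMap.IsIdempotentElem.eq_zero_of_trace_eq_zero h1 (by
    rw [Matrix.trace_toLin'_eq]
    have := AddMonoidHom.map_trace (algebraMap R L).toAddMonoidHom B
    rw [ht] at this
    simpa using this.symm)
  apply Matrix.map_injective hinj
  beta_reduce
  rw [Matrix.map_zero _ (map_zero _)]
  exact Matrix.toLin'.injective (by rw [h2, map_zero])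

/-- Let `X` be an integral representation of `G` whose character on the normal subgroup `K` is
induced from that of `Y`. Then the central idempotent of `Y` acts as a nonzero map on every nonzero
quotient of a reduction of `X`. -/
theorem lift_centralIdempotent_ne_zero [IsDomain R] [CharZero R] [Fintype G] (K : Subgroup G)
    [K.Normal] [Fintype K] {d n N : ℕ} {Y : K →* Matrix (Fin d) (Fin d) R} {c : Rˣ}
    (hY : SchurOrthogonal Y (c : R)) (X : G →* Matrix (Fin n) (Fin n) R)
    (hX : ∀ k : K, (Fintype.card K : R) * (X k).trace
      = ∑ x : G, (Y (MulAut.conjNormal x⁻¹ k)).trace)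
    (V : G →* Matrix (Fin N) (Fin N) F) (hN : N ≠ 0)
    (π : (Fin n → F) →ₗ[F] (Fin N → F)) (hsurj : Function.Surjective π)
    (hπ : ∀ g u, π ((mapMatRep (algebraMap R F) X g).mulVec u) = (V g).mulVec (π u)) :
    MonoidAlgebra.lift R _ K (V.comp K.subtype) (centralIdempotent Y c) ≠ 0 := by
  intro h0
  let Yc : G → K →* Matrix (Fin d) (Fin d) R := fun x =>
    Y.comp (MulAut.conjNormal x⁻¹ : MulAut K).toMonoidHom
  have hYc : ∀ x, SchurOrthogonal (Yc x) (c : R) := fun x => hY.comp_equiv _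
  obtain ⟨z, hz, hz0, hz1⟩ := exists_complementary_idempotent
    (fun x => centralIdempotent (Yc x) c) (fun x => centralIdempotent_mem_center _ c)
    (fun x => (hYc x).isIdempotentElem)
  -- On `V` the idempotents of conjugate representations are conjugate under `G`, so they vanish
  -- together.
  have hconj : ∀ x, MonoidAlgebra.lift R _ K (V.comp K.subtype) (centralIdempotent (Yc x) c) = 0 := by
    intro x
    have : MonoidAlgebra.lift R _ K (V.comp K.subtype) (centralIdempotent (Yc x) c)
        = V x * MonoidAlgebra.lift R _ K (V.comp K.subtype) (centralIdempotent Y c) * V x⁻¹ := by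
      rw [lift_centralIdempotent, lift_centralIdempotent, mul_smul_comm, smul_mul_assoc,
        Finset.mul_sum, Finset.sum_mul]
      congr 1
      symm
      refine Fintype.sum_equiv (MulAut.conjNormal x : MulAut K).toEquiv _ _ fun k => ?_
      rw [mul_smul_comm, smul_mul_assoc]
      congr 1
      · simp [Yc, ← map_inv, ← MulAut.mul_apply, ← map_mul]
      · simp [← map_mul]
    rw [this, h0, mul_zero, zero_mul]
  -- The character identity extended linearly to `R[K]`, so that it applies to `z`, whose trace on
  -- every conjugate of `Y` is zero.
  have htr : ∀ a : R[K], (Fintype.card K : R) *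
      (MonoidAlgebra.lift R _ K (X.comp K.subtype) a).trace
        = ∑ x, (MonoidAlgebra.lift R _ K (Yc x) a).trace := by
    intro a
    induction a using MonoidAlgebra.induction_on with
    | of h => simpa [Yc] using hX h
    | add a b ha hb =>
      simp only [map_add, Matrix.trace_add, mul_add, ha, hb, Finset.sum_add_distrib]
    | smul r a ha =>
      simp only [map_smul, Matrix.trace_smul, smul_eq_mul, ← Finset.mul_sum, ← ha]
      ring
  have hB : MonoidAlgebra.lift R _ K (X.comp K.subtype) z = 0 := by
    refine matrix_eq_zero_of_isIdempotentElem (hz.map _) ?_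
    have h1 := htr z
    rw [Finset.sum_eq_zero fun x _ => ?_] at h1
    · exact (mul_eq_zero.1 h1).resolve_left (Nat.cast_ne_zero.2 Fintype.card_ne_zero)
    · obtain ⟨y, hy⟩ := hz0 x
      rw [hy, map_mul, map_sub, map_one, (hYc x).lift_centralIdempotent, sub_self, zero_mul,
        Matrix.trace_zero]
  have hV : MonoidAlgebra.lift R _ K (V.comp K.subtype) z = 1 :=
    hz1 (MonoidAlgebra.lift R _ K (V.comp K.subtype)).toRingHom hconj
  have hU : MonoidAlgebra.lift R _ K (mapMatRep (algebraMap R F) (X.comp K.subtype)) z = 0 := by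
    rw [lift_mapMatRep, hB, Matrix.map_zero _ (map_zero _)]
  obtain ⟨u, hu⟩ := hsurj fun _ => 1
  have := lift_mulVec_intertwine (mapMatRep (algebraMap R F) (X.comp K.subtype)) (V.comp K.subtype)
    π (fun k u => hπ k u) z u
  rw [hU, hV, Matrix.zero_mulVec, map_zero, Matrix.one_mulVec, hu] at this
  exact zero_ne_one (congrFun this ⟨0, Nat.pos_of_ne_zero hN⟩)
end

/-! ### Actions of `p`-groups in characteristic `p` -/

/-- Counting needs a finite set, and `F` may be infinite; so the argument runs in the additive group
generated by one orbit, which is finite of order divisible by `p`. Since `0` is fixed there, so is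
another element. -/
theorem IsPGroup.exists_fixed_vector {p : ℕ} [Fact p.Prime] {I : Type*} [Group I] [Finite I]
    (hI : IsPGroup p I) {F H : Type*} [Field F] [CharP F p] [AddCommGroup H] [Module F H]
    [Nontrivial H] (ρ : Representation F I H) : ∃ v ≠ 0, ∀ x, ρ x v = v := by
  obtain ⟨v, hv⟩ := exists_ne (0 : H)
  let A : AddSubgroup H := AddSubgroup.closure (Set.range fun x => ρ x v)
  have hp : ∀ w : H, p • w = 0 := fun w => by
    rw [← Nat.cast_smul_eq_nsmul F, CharP.cast_eq_zero, zero_smul]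
  have hst : ∀ x, ∀ w ∈ A, ρ x w ∈ A := by
    intro x
    change A ≤ A.comap (ρ x).toAddMonoidHom
    rw [AddSubgroup.closure_le]
    rintro _ ⟨y, rfl⟩
    exact AddSubgroup.subset_closure ⟨x * y, by simp⟩
  have hfin : Finite A := by
    have : AddGroup.FG A := AddGroup.closure_finite_fg _
    refine AddCommGroup.finite_of_fg_isAddTorsion A fun a => ?_
    exact isOfFinAddOrder_iff_nsmul_eq_zero.2
      ⟨p, (Fact.out : p.Prime).pos, Subtype.ext (hp a)⟩
  let act : MulAction I A :=
    { smul := fun x a => ⟨ρ x a, hst x a a.2⟩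
      one_smul := fun a => Subtype.ext (by change ρ 1 (a : H) = a; simp)
      mul_smul := fun x y a => Subtype.ext (by change ρ (x * y) (a : H) = ρ x (ρ y a); simp) }
  have hdvd : p ∣ Nat.card A := by
    have hvA : v ∈ A := AddSubgroup.subset_closure ⟨1, by simp⟩
    have : addOrderOf (⟨v, hvA⟩ : A) = p :=
      addOrderOf_eq_prime (Subtype.ext (hp v)) fun h => hv (congrArg Subtype.val h)
    exact this ▸ addOrderOf_dvd_natCard _
  obtain ⟨b, hb, hb0⟩ := hI.exists_fixed_point_of_prime_dvd_card_of_fixed_point A hdvd (a := 0)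
    fun x => Subtype.ext (map_zero (ρ x))
  exact ⟨b, fun h => hb0 (Subtype.ext h.symm), fun x => congrArg Subtype.val (hb x)⟩

/-- A `p`-group fixing the isomorphism class of an absolutely irreducible representation in
characteristic `p` acts on it. -/
theorem exists_monoidHom_intertwining {p : ℕ} [Fact p.Prime] {I : Type*} [Group I] [Finite I]
    (hI : IsPGroup p I) {F : Type*} [Field F] [CharP F p] [PerfectRing F p] {K : Type*} [Group K]
    [Fintype K] (σ : I →* MulAut K) {d : ℕ} (hd : d ≠ 0) {W : K →* Matrix (Fin d) (Fin d) F} {c : F}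
    (hW : SchurOrthogonal W c) (hc : c ≠ 0) (hK : (Fintype.card K : F) ≠ 0)
    (htr : ∀ x k, (W (σ x k)).trace = (W k).trace) :
    ∃ N : I →* Matrix (Fin d) (Fin d) F, ∀ x k, N x * W k = W (σ x k) * N x := by
  have : Fintype I := Fintype.ofFinite I
  have : Nonempty (Fin d) := ⟨⟨0, Nat.pos_of_ne_zero hd⟩⟩
  have hM : ∀ x, ∃ B : (Matrix (Fin d) (Fin d) F)ˣ, ∀ k, W (σ x k) * B = B * W k := by
    intro x
    obtain ⟨B, ⟨B, rfl⟩, hB⟩ := exists_intertwiner (W := W.comp (σ x).toMonoidHom) hW hc hK hd (htr x)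
    exact ⟨B, hB⟩
  choose M hM using hM
  have hinj : ∀ x, Function.Injective fun a : F => a • (M x : Matrix (Fin d) (Fin d) F) :=
    fun x => smul_left_injective F (M x).ne_zero
  -- Both sides intertwine the same two representations, so they differ by a scalar: `M` is a
  -- projective representation with cocycle `α`.
  have hα : ∀ x y, ∃ a : F, (M x * M y : Matrix (Fin d) (Fin d) F) = a • (M (x * y) : Matrix (Fin d) (Fin d) F) := by
    intro x y
    obtain ⟨a, ha⟩ := hW.eq_smul_one hK ((M (x * y))⁻¹ * M x * M y : _ˣ) fun k => by
      have h1 : W k * ((M (x * y))⁻¹ : _ˣ)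
          = ((M (x * y))⁻¹ : _ˣ) * W (σ (x * y) k) := by
        rw [Units.eq_inv_mul_iff_mul_eq, ← mul_assoc, ← hM, mul_assoc, Units.mul_inv, mul_one]
      rw [Units.val_mul, Units.val_mul, ← mul_assoc, ← mul_assoc, h1, map_mul, MulAut.mul_apply,
        mul_assoc _ (W _) (M x : Matrix (Fin d) (Fin d) F), hM, mul_assoc, mul_assoc _ (W _) (M y : Matrix (Fin d) (Fin d) F),
        hM]
      simp only [mul_assoc]
    refine ⟨a, ?_⟩
    rw [Units.val_mul, Units.val_mul, mul_assoc, Units.inv_mul_eq_iff_eq_mul] at ha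
    rw [ha, mul_smul_comm, mul_one]
  choose α hα using hα
  have hcoc : ∀ x y z, α x y * α (x * y) z = α y z * α x (y * z) := by
    intro x y z
    apply hinj (x * y * z)
    change (α x y * α (x * y) z) • (M (x * y * z) : Matrix (Fin d) (Fin d) F)
      = (α y z * α x (y * z)) • (M (x * y * z) : Matrix (Fin d) (Fin d) F)
    rw [mul_smul, ← hα, mul_smul, mul_assoc x y z, ← hα, ← smul_mul_assoc, ← hα, ← mul_smul_comm,
      ← hα, mul_assoc]
  have hα0 : ∀ x y, α x y ≠ 0 := by
    intro x y h
    have := hα x y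
    rw [h, zero_smul, ← Units.val_mul] at this
    exact (M x * M y).ne_zero this
  obtain ⟨b, hb⟩ := hI.exists_card_eq
  let fr := iterateFrobeniusEquiv F p b
  -- Multiplying the cocycle identity over all `z` shows that `α ^ |I|` is the coboundary of `x ↦ ∏
  -- α(x, z)`. As `|I| = p ^ b` and `F` is perfect, `|I|`-th roots exist and are unique, so `α` is
  -- the coboundary of `β`, and dividing `M` by `β` gives a homomorphism.
  let β : I → F := fun x => fr.symm (∏ z, α x z)
  have hβ0 : ∀ x, β x ≠ 0 := fun x =>
    (map_ne_zero_iff _ fr.symm.injective).2 (Finset.prod_ne_zero_iff.2 fun z _ => hα0 x z)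
  have hβ : ∀ x y, α x y * β (x * y) = β x * β y := by
    intro x y
    apply fr.injective
    rw [map_mul, map_mul]
    simp only [β, RingEquiv.apply_symm_apply]
    have h1 : fr (α x y) = ∏ _z : I, α x y := by
      rw [Finset.prod_const, Finset.card_univ, ← Nat.card_eq_fintype_card, hb]
      exact iterateFrobeniusEquiv_def F p b _
    rw [h1, ← Finset.prod_mul_distrib, Finset.prod_congr rfl fun z _ => hcoc x y z,
      Finset.prod_mul_distrib, mul_comm]
    congr 1
    exact Fintype.prod_equiv (Equiv.mulLeft y) _ _ fun z => rfl
  let N : I → (Matrix (Fin d) (Fin d) F)ˣ := fun x => (Units.mk0 (β x) (hβ0 x))⁻¹ • M x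
  have hN : ∀ x, (N x : Matrix (Fin d) (Fin d) F) = (β x)⁻¹ • (M x : Matrix (Fin d) (Fin d) F) := fun x => rfl
  have hmul : ∀ x y, N (x * y) = N x * N y := by
    intro x y
    ext1
    rw [Units.val_mul, hN, hN, hN, smul_mul_smul_comm, hα, smul_smul]
    congr 1
    have h1 := hβ x y
    have h2 := hβ0 x
    have h3 := hβ0 y
    have h4 := hβ0 (x * y)
    field_simp
    rw [← h1, mul_comm]
  refine ⟨(Units.coeHom _).comp (MonoidHom.mk' N hmul), fun x k => ?_⟩
  change (N x : Matrix (Fin d) (Fin d) F) * W k = W (σ x k) * (N x : Matrix (Fin d) (Fin d) F)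
  rw [hN, smul_mul_assoc, mul_smul_comm, hM]

/-! ### Clifford theory for a normal `p`-complement -/

section
variable {F V G : Type*} [Field F] [AddCommGroup V] [Module F V] [Group G]

/-- `V` is spanned by the translates of a nonzero subspace stable under `K`, if `G = PK`. -/
theorem iSup_map_eq_top {ρ : Representation F G V} (hρ : ρ.IsIrreducible) (K P : Subgroup G)
    (hKP : ∀ g, ∃ x ∈ P, ∃ k ∈ K, g = x * k) (D : Submodule F V) (hD : D ≠ ⊥)
    (hDK : ∀ k ∈ K, ∀ v ∈ D, ρ k v ∈ D) : ⨆ x : P, D.map (ρ x) = ⊤ := by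
  refine (eq_bot_or_eq_top_of_isIrreducible hρ _ fun g => ?_).resolve_left fun h => hD ?_
  · change ⨆ x : P, D.map (ρ x) ≤ (⨆ x : P, D.map (ρ x)).comap (ρ g)
    refine iSup_le fun x => ?_
    rw [Submodule.map_le_iff_le_comap]
    intro v hv
    obtain ⟨y, hy, k, hk, hgx⟩ := hKP (g * x)
    refine Submodule.mem_iSup_of_mem ⟨y, hy⟩ ⟨ρ k v, hDK k hk v hv, ?_⟩
    rw [← Module.End.mul_apply, ← map_mul, ← hgx, map_mul, Module.End.mul_apply]
  · rw [eq_bot_iff, ← h]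
    refine le_trans (le_of_eq ?_) (le_iSup _ (1 : P))
    simp [Module.End.one_eq_id]

/-- Let `V` be induced from the `I`-stable subspace `D`, with projection `e`. Then
`dim V = |P : I| dim D`, and the `P`-fixed points of `V` have the dimension of `D` if and only if
`I` acts trivially on `D`. -/
theorem finrank_of_imprimitive [FiniteDimensional F V] {ρ : Representation F G V}
    (P I : Subgroup G) [Finite P] (hIP : I ≤ P) (D : Submodule F V)
    (hDI : ∀ x ∈ I, ∀ v ∈ D, ρ x v ∈ D) (htop : ⨆ x : P, D.map (ρ x) = ⊤) (e : V →ₗ[F] V)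
    (he1 : ∀ v ∈ D, e v = v) (he0 : ∀ x ∈ P, x ∉ I → ∀ v ∈ D, e (ρ x v) = 0) :
    Module.finrank F V = I.relIndex P * Module.finrank F D ∧
      (Module.finrank F (Representation.invariants (ρ.comp P.subtype)) = Module.finrank F D ↔
        ∀ x ∈ I, ∀ v ∈ D, ρ x v = v) := by
  classical
  let Q := P ⧸ I.subgroupOf P
  have : Fintype Q := Fintype.ofFinite Q
  have hcomp : ∀ (x y : G) (v : V), ρ x (ρ y v) = ρ (x * y) v := fun x y v => by
    rw [map_mul, Module.End.mul_apply]
  -- Linear maps are compared on the translates of `D`; this shows that `e` has image in `D` and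
  -- commutes with `I`.
  have hext : ∀ {U : Type _} [AddCommGroup U] [Module F U] (a b : V →ₗ[F] U),
      (∀ x : P, ∀ v ∈ D, a (ρ x v) = b (ρ x v)) → a = b := by
    intro U _ _ a b h
    rw [← LinearMap.eqLocus_eq_top, eq_top_iff, ← htop]
    refine iSup_le fun x => ?_
    rintro _ ⟨v, hv, rfl⟩
    exact h x v hv
  have heD : ∀ v, e v ∈ D := by
    have : D.mkQ.comp e = 0 := hext _ _ fun x v hv => by
      rw [LinearMap.comp_apply, LinearMap.zero_apply, Submodule.mkQ_apply,
        Submodule.Quotient.mk_eq_zero]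
      by_cases hx : (x : G) ∈ I
      · rw [he1 _ (hDI x hx v hv)]
        exact hDI x hx v hv
      · rw [he0 x x.2 hx v hv]
        exact D.zero_mem
    intro v
    have h := LinearMap.congr_fun this v
    rwa [LinearMap.comp_apply, LinearMap.zero_apply, Submodule.mkQ_apply,
      Submodule.Quotient.mk_eq_zero] at h
  have hecomm : ∀ x ∈ I, ∀ v, e (ρ x v) = ρ x (e v) := by
    intro x hx
    have : e.comp (ρ x) = (ρ x).comp e := hext _ _ fun y v hv => by
      rw [LinearMap.comp_apply, LinearMap.comp_apply, hcomp]
      by_cases hy : (y : G) ∈ I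
      · rw [he1 _ (hDI y hy v hv), he1 _ (hDI _ (I.mul_mem hx hy) v hv), hcomp]
      · rw [he0 y y.2 hy v hv, he0 _ (P.mul_mem (hIP hx) y.2)
          (fun h => hy ((I.mul_mem_cancel_left hx).1 h)) v hv, map_zero]
    exact LinearMap.congr_fun this
  let Φ : (Q → D) →ₗ[F] V :=
    ∑ q : Q, (ρ (q.out : P)).comp (D.subtype.comp (LinearMap.proj q))
  have hΦ : ∀ f, Φ f = ∑ q : Q, ρ (q.out : P) (f q : V) := fun f => by
    simp only [Φ, LinearMap.sum_apply]
    rfl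
  -- Translating by `r⁻¹` and applying `e` reads off the component at the coset `r`; this yields
  -- independence of the translates.
  have heΦ : ∀ f (r : Q), e (ρ ((r.out : P)⁻¹ : P) (Φ f)) = f r := by
    intro f r
    rw [hΦ, map_sum, map_sum, Finset.sum_eq_single r]
    · rw [hcomp, ← Subgroup.coe_mul, inv_mul_cancel, Subgroup.coe_one, map_one,
        Module.End.one_apply, he1 _ (f r).2]
    · intro q _ hq
      rw [hcomp, ← Subgroup.coe_mul]
      refine he0 _ (SetLike.coe_mem _) (fun h => hq ?_) _ (f q).2
      have h1 : ((r.out : P) : Q) = ((q.out : P) : Q) :=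
        QuotientGroup.eq.2 (Subgroup.mem_subgroupOf.2 h)
      rw [QuotientGroup.out_eq', QuotientGroup.out_eq'] at h1
      exact h1.symm
    · intro h
      exact absurd (Finset.mem_univ r) h
  have hΦinj : Function.Injective Φ := by
    intro f f' h
    ext r
    rw [← heΦ f, ← heΦ f', h]
  have hΦsurj : Function.Surjective Φ := by
    rw [← LinearMap.range_eq_top, eq_top_iff, ← htop]
    refine iSup_le fun x => ?_
    rintro _ ⟨v, hv, rfl⟩
    have hxI : (((x : Q).out⁻¹ * x : P) : G) ∈ I :=
      Subgroup.mem_subgroupOf.1 (QuotientGroup.eq.1 (QuotientGroup.out_eq' (x : Q)))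
    refine ⟨Pi.single (x : Q) ⟨_, hDI _ hxI v hv⟩, ?_⟩
    rw [hΦ, Finset.sum_eq_single (x : Q)]
    · rw [Pi.single_eq_same]
      change ρ _ (ρ _ v) = _
      rw [hcomp, ← Subgroup.coe_mul, mul_inv_cancel_left]
    · intro q _ hq
      rw [Pi.single_eq_of_ne hq]
      simp
    · intro h
      exact absurd (Finset.mem_univ _) h
  refine ⟨?_, ?_⟩
  · rw [← (LinearEquiv.ofBijective Φ ⟨hΦinj, hΦsurj⟩).finrank_eq, Module.finrank_pi_fintype,
      Finset.sum_const, Finset.card_univ, smul_eq_mul, Subgroup.relIndex, Subgroup.index,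
      Nat.card_eq_fintype_card]
  -- A `P`-fixed vector has all its components equal to its image under `e`, so `e` is injective on
  -- fixed points, and equality of dimensions means surjectivity onto `D`.
  let E : Representation.invariants (ρ.comp P.subtype) →ₗ[F] D :=
    (e.codRestrict D heD).comp (Submodule.subtype _)
  have hinv : ∀ v ∈ Representation.invariants (ρ.comp P.subtype), ∀ x : P, ρ x v = v :=
    fun v hv x => hv x
  have hE : ∀ v, (E v : V) = e v := fun v => rfl
  have hEinj : Function.Injective E := by
    rw [← LinearMap.ker_eq_bot, LinearMap.ker_eq_bot']
    rintro ⟨v, hv⟩ h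
    have h0 : e v = 0 := congrArg Subtype.val h
    obtain ⟨f, rfl⟩ := hΦsurj v
    have : f = 0 := by
      ext r
      rw [← heΦ f r, hinv _ hv, h0]
      rfl
    subst this
    exact Subtype.ext (map_zero Φ)
  have hsurj : Module.finrank F (Representation.invariants (ρ.comp P.subtype)) = Module.finrank F D
      ↔ Function.Surjective E :=
    ⟨fun h => (LinearMap.injective_iff_surjective_of_finrank_eq_finrank h).1 hEinj,
      fun h => (LinearEquiv.ofBijective E ⟨hEinj, h⟩).finrank_eq⟩
  rw [hsurj]
  constructor
  · intro h x hx w hw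
    obtain ⟨⟨v, hv⟩, hvw⟩ := h ⟨w, hw⟩
    have h1 : e v = w := congrArg Subtype.val hvw
    rw [← h1, ← hecomm x hx, hinv v hv ⟨x, hIP hx⟩]
  · rintro h ⟨w, hw⟩
    -- When `I` fixes `w`, the translate of `w` depends only on the coset, so the sum of these
    -- translates over `P/I` is fixed by `P` and has component `w`.
    let f : Q → D := fun _ => ⟨w, hw⟩
    have hv : ∀ x : P, ρ x (Φ f) = Φ f := by
      intro x
      rw [hΦ, map_sum]
      refine Fintype.sum_equiv (MulAction.toPerm x) _ _ fun q => ?_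
      rw [MulAction.toPerm_apply, hcomp, ← Subgroup.coe_mul]
      have h1 : ((x • q : Q).out⁻¹ * (x * q.out) : P) ∈ I.subgroupOf P := by
        rw [← QuotientGroup.eq, QuotientGroup.out_eq']
        conv_lhs => rw [← QuotientGroup.out_eq' q]
        rfl
      have h2 := h _ (Subgroup.mem_subgroupOf.1 h1) w hw
      calc ρ (x * q.out : P) w = ρ ((x • q : Q).out : P) (ρ ((x • q : Q).out⁻¹ * (x * q.out) : P) w) := by
            rw [hcomp, ← Subgroup.coe_mul, mul_inv_cancel_left]
        _ = _ := by rw [h2]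
    refine ⟨⟨Φ f, hv⟩, Subtype.ext ?_⟩
    rw [hE, ← heΦ f ((1 : P) : Q)]
    exact congrArg e (hv _).symm

end

section
variable {p : ℕ} [Fact p.Prime] {F : Type*} [Field F] [CharP F p] [PerfectRing F p]
  {G : Type*} [Group G] {K : Subgroup G} [K.Normal] [Fintype K] {d : ℕ}

/-- An irreducible representation of `K` in a representation of `G` embeds equivariantly for an
action of a `p`-subgroup of its inertia group. -/
theorem exists_equivariant_embedding {V : Type*} [AddCommGroup V] [Module F V]
    (ρ : Representation F G V) (I : Subgroup G) [Finite I] (hI : IsPGroup p I)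
    {W : K →* Matrix (Fin d) (Fin d) F} {c : F} (hW : SchurOrthogonal W c) (hc : c ≠ 0)
    (hd : d ≠ 0) (hK : (Fintype.card K : F) ≠ 0)
    (htr : ∀ x ∈ I, ∀ k, (W (MulAut.conjNormal x k)).trace = (W k).trace)
    (he : ∑ k, (W k⁻¹).trace • ρ k ≠ 0) :
    ∃ (f : (Fin d → F) →ₗ[F] V) (N : I →* Matrix (Fin d) (Fin d) F), Function.Injective f ∧
      (∀ (k : K) w, f ((W k).mulVec w) = ρ k (f w)) ∧
      (∀ x w, f ((N x).mulVec w) = ρ x (f w)) ∧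
      ∀ (x : I) k, N x * W k = W (MulAut.conjNormal (x : G) k) * N x := by
  obtain ⟨N, hN⟩ := exists_monoidHom_intertwining hI
    ((MulAut.conjNormal (H := K)).comp I.subtype) hd hW hc hK fun x k => htr x x.2 k
  have hN' : ∀ (x : I) (k : K), N x * W k = W (MulAut.conjNormal (x : G) k) * N x := hN
  -- `H` is the space `Hom_K(W, V)`.
  let H : Submodule F ((Fin d → F) →ₗ[F] V) :=
    { carrier := {f | ∀ (k : K) w, f ((W k).mulVec w) = ρ k (f w)}
      zero_mem' := fun k w => by simp
      add_mem' := fun {a b} ha hb k w => by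
        rw [LinearMap.add_apply, LinearMap.add_apply, ha, hb, map_add]
      smul_mem' := fun r a ha k w => by
        rw [LinearMap.smul_apply, LinearMap.smul_apply, ha, map_smul] }
  have hHne : Nontrivial H := by
    obtain ⟨v, hv⟩ : ∃ v, (∑ k, (W k⁻¹).trace • ρ k) v ≠ 0 := by
      by_contra! h
      exact he (LinearMap.ext h)
    have h1 : (∑ k, (W k⁻¹).trace • ρ k) v = ∑ i, ∑ k, W k⁻¹ i i • ρ k v := by
      rw [Finset.sum_comm, LinearMap.sum_apply]
      refine Finset.sum_congr rfl fun k _ => ?_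
      rw [LinearMap.smul_apply, Matrix.trace, Finset.sum_smul]
      rfl
    rw [h1] at hv
    obtain ⟨i, -, hi⟩ := Finset.exists_ne_zero_of_sum_ne_zero hv
    -- The average over `K` of the rank-one map `w ↦ wᵢ v`; its value at `eᵢ` is the nonzero summand
    -- found in `hi`.
    let f : (Fin d → F) →ₗ[F] V :=
      ∑ k : K, (LinearMap.toSpanSingleton F V (ρ k v)).comp
        ((LinearMap.proj i).comp (Matrix.mulVecLin (W k⁻¹)))
    have hf : ∀ w, f w = ∑ k : K, (W k⁻¹).mulVec w i • ρ k v := fun w => by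
      simp [f]
    refine ⟨⟨f, fun h w => ?_⟩, 0, fun h0 => hi ?_⟩
    · rw [hf, hf, map_sum]
      symm
      refine Fintype.sum_equiv (Equiv.mulLeft h) _ _ fun k => ?_
      rw [map_smul, Matrix.mulVec_mulVec, ← map_mul]
      simp
    · have h2 : f (Pi.single i 1) = 0 := by
        rw [show f = 0 from congrArg Subtype.val h0]
        rfl
      rw [hf] at h2
      simpa using h2
  -- The action `x · f = ρ(x) f N(x)⁻¹`; a fixed vector is an embedding equivariant for `I`.
  let τ : Representation F I H :=
    { toFun := fun x =>
        { toFun := fun f => ⟨(ρ x).comp (f.1.comp (N x⁻¹).mulVecLin), fun k w => by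
            simp only [LinearMap.comp_apply, Matrix.mulVecLin_apply]
            rw [Matrix.mulVec_mulVec, hN', ← Matrix.mulVec_mulVec, f.2, ← Module.End.mul_apply,
              ← Module.End.mul_apply, ← map_mul, ← map_mul]
            simp [mul_assoc]⟩
          map_add' := fun f g => by ext; simp
          map_smul' := fun r f => by ext; simp }
      map_one' := by ext; simp
      map_mul' := fun x y => by ext; simp }
  obtain ⟨⟨f, hf⟩, hf0, hfix⟩ := hI.exists_fixed_vector τ
  refine ⟨f, N, ?_, hf, fun x w => ?_, hN'⟩
  · rw [← LinearMap.ker_eq_bot]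
    refine (hW.eq_bot_or_eq_top hc _ fun k v hv => ?_).resolve_right fun h => hf0 ?_
    · rw [LinearMap.mem_ker] at hv ⊢
      rw [hf, hv, map_zero]
    · exact Subtype.ext (LinearMap.ker_eq_top.1 h)
  · have h1 := LinearMap.congr_fun (congrArg Subtype.val (hfix x)) ((N x).mulVec w)
    rw [← h1]
    change ρ x (f ((N x⁻¹).mulVec ((N x).mulVec w))) = _
    rw [Matrix.mulVec_mulVec, ← map_mul, inv_mul_cancel, map_one, Matrix.one_mulVec]

/-- The dimension of an irreducible representation of `G = PK` lying over `W`, and the criterion for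
its `P`-fixed points to have dimension `dim W`. -/
theorem finrank_and_finrank_invariants_iff {V : Type*} [AddCommGroup V] [Module F V]
    [FiniteDimensional F V] {ρ : Representation F G V} (hρ : ρ.IsIrreducible)
    (P I : Subgroup G) [Finite P] (hP : IsPGroup p P) (hIP : I ≤ P)
    (hKP : ∀ g, ∃ x ∈ P, ∃ k ∈ K, g = x * k)
    {W : K →* Matrix (Fin d) (Fin d) F} {c : F} (hW : SchurOrthogonal W c) (hc : c ≠ 0)
    (hd : d ≠ 0) (hK : (Fintype.card K : F) ≠ 0)
    (htr : ∀ x ∈ I, ∀ k, (W (MulAut.conjNormal x k)).trace = (W k).trace)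
    (hout : ∀ x ∈ P, x ∉ I → ∑ k, (W k⁻¹).trace • W (MulAut.conjNormal x⁻¹ k) = 0)
    (he : ∑ k, (W k⁻¹).trace • ρ k ≠ 0) :
    Module.finrank F V = I.relIndex P * d ∧
      (Module.finrank F (Representation.invariants (ρ.comp P.subtype)) = d ↔
        ∀ x ∈ I, ∀ k, W (MulAut.conjNormal x k) = W k) := by
  have : Finite I := Finite.of_injective _ (Subgroup.inclusion_injective hIP)
  have hI : IsPGroup p I := hP.to_le hIP
  have : Nonempty (Fin d) := ⟨⟨0, Nat.pos_of_ne_zero hd⟩⟩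
  obtain ⟨f, N, hinj, hfW, hfN, hN⟩ := exists_equivariant_embedding ρ I hI hW hc hd hK htr he
  have hfsum : ∀ (a : K → F) (σ : K → K) w,
      f ((∑ k, a k • W (σ k)).mulVec w) = ∑ k, a k • ρ (σ k) (f w) := by
    intro a σ w
    rw [Matrix.sum_mulVec, map_sum]
    exact Finset.sum_congr rfl fun k _ => by rw [Matrix.smul_mulVec, map_smul, hfW]
  have hDd : Module.finrank F (LinearMap.range f) = d := by
    rw [LinearMap.finrank_range_of_inj hinj, Module.finrank_fin_fun]
  have hD0 : LinearMap.range f ≠ ⊥ := fun h => hd (by rw [← hDd, h, finrank_bot])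
  have hDK : ∀ k ∈ K, ∀ v ∈ LinearMap.range f, ρ k v ∈ LinearMap.range f := by
    rintro k hk _ ⟨w, rfl⟩
    exact ⟨_, hfW ⟨k, hk⟩ w⟩
  have hDI : ∀ x ∈ I, ∀ v ∈ LinearMap.range f, ρ x v ∈ LinearMap.range f := by
    rintro x hx _ ⟨w, rfl⟩
    exact ⟨_, hfN ⟨x, hx⟩ w⟩
  obtain ⟨h1, h2⟩ := finrank_of_imprimitive P I hIP (LinearMap.range f) hDI
    (iSup_map_eq_top hρ K P hKP _ hD0 hDK) (c⁻¹ • ∑ k, (W k⁻¹).trace • ρ k) (by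
      rintro _ ⟨w, rfl⟩
      have := hfsum (fun k => (W k⁻¹).trace) id w
      simp only [id] at this
      rw [hW.sum_trace_inv_smul, Matrix.smul_mulVec, Matrix.one_mulVec, map_smul] at this
      rw [LinearMap.smul_apply, LinearMap.sum_apply]
      simp only [LinearMap.smul_apply]
      rw [← this, smul_smul, inv_mul_cancel₀ hc, one_smul]) (by
      rintro x hx hxI _ ⟨w, rfl⟩
      have := hfsum (fun k => (W k⁻¹).trace) (MulAut.conjNormal x⁻¹) w
      rw [hout x hx hxI, Matrix.zero_mulVec, map_zero] at this
      rw [LinearMap.smul_apply, LinearMap.sum_apply, Finset.sum_congr rfl fun k _ =>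
        show ((W k⁻¹).trace • ρ k) (ρ x (f w))
          = ρ x ((W k⁻¹).trace • ρ (MulAut.conjNormal x⁻¹ k : K) (f w)) from ?_, ← map_sum,
        ← this, map_zero, smul_zero]
      rw [LinearMap.smul_apply, map_smul, ← Module.End.mul_apply, ← Module.End.mul_apply,
        ← map_mul, ← map_mul]
      simp [mul_assoc])
  rw [hDd] at h1 h2
  refine ⟨h1, h2.trans ?_⟩
  constructor
  · intro h x hx k
    apply Matrix.toLin'.injective
    refine LinearMap.ext fun w => hinj ?_
    rw [Matrix.toLin'_apply, Matrix.toLin'_apply, hfW, hfW, MulAut.conjNormal_apply, map_mul,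
      map_mul, Module.End.mul_apply, Module.End.mul_apply, h _ (I.inv_mem hx) _ ⟨w, rfl⟩,
      h _ hx _ (hDK k k.2 _ ⟨w, rfl⟩)]
  · rintro h x hx _ ⟨w, rfl⟩
    -- If conjugation by `x` does not change `W`, then `N x` is a scalar `a` with `a ^ p ^ b = 1`,
    -- and injectivity of Frobenius forces `a = 1`.
    obtain ⟨a, ha⟩ := hW.eq_smul_one hK (N ⟨x, hx⟩) fun k => by rw [hN, h x hx]
    obtain ⟨b, hb⟩ := hI ⟨x, hx⟩
    have h3 : a ^ p ^ b = 1 := by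
      have h4 := congrArg N hb
      rw [map_pow, ha, _root_.smul_pow, one_pow, map_one] at h4
      have h5 := congrFun (congrFun h4 (Classical.arbitrary _)) (Classical.arbitrary _)
      simpa using h5
    have h4 : a = 1 := by
      apply iterateFrobenius_inj F p b
      rw [iterateFrobenius_def, iterateFrobenius_def, h3, one_pow]
    rw [← hfN ⟨x, hx⟩ w, ha, h4, one_smul, Matrix.one_mulVec]

end

/-! ### Residue field, head of a PIM, `G = PK`, and the main theorem -/

theorem ValuationSubring.perfectRing_residueField (p : ℕ) [Fact p.Prime] {L : Type*} [Field L]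
    [IsAlgClosed L] (O : ValuationSubring L) [CharP (ResidueField O) p] :
    PerfectRing (ResidueField O) p := by
  have hp : 0 < p := (Fact.out : p.Prime).pos
  refine PerfectRing.ofSurjective _ _ fun a => ?_
  obtain ⟨z, rfl⟩ := IsLocalRing.residue_surjective a
  obtain ⟨y, hy⟩ := IsAlgClosed.exists_pow_nat_eq (z : L) hp
  have hmem : y ∈ O := by
    rcases O.mem_or_inv_mem y with h | h
    · exact h
    · rcases eq_or_ne y 0 with rfl | h0
      · exact O.zero_mem
      -- Should only `y⁻¹` be known to be integral, `y ^ p = z` still exhibits `y` as a product of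
      -- elements of `O`.
      have h1 : y = z * y⁻¹ ^ (p - 1) := by
        rw [← hy, inv_pow, ← div_eq_mul_inv, eq_div_iff (pow_ne_zero _ h0), ← pow_succ',
          Nat.sub_add_cancel hp]
      rw [h1]
      exact O.mul_mem _ _ z.2 (pow_mem h _)
  refine ⟨residue O ⟨y, hmem⟩, ?_⟩
  rw [frobenius_def, ← map_pow]
  exact congrArg _ (Subtype.ext hy)

theorem IsPIM.exists_surjective {p : ℕ} {O : ValuationSubring ℂ} {G : Type*} [Group G]
    {φ : IBr p O G} {V : Type*} [AddCommGroup V] [Module (ResidueField O) V]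
    {ρ : Representation (ResidueField O) G V} (h : IsPIM φ ρ) :
    ∃ π : V →ₗ[ResidueField O] (Fin φ.degree → ResidueField O), Function.Surjective π ∧
      ∀ g v, π (ρ g v) = φ.rep g (π v) := by
  obtain ⟨ε⟩ := h.head
  let q : ρ.asModule →ₗ[(ResidueField O)[G]] φ.rep.asModule :=
    ε.toLinearMap.comp (Submodule.mkQ _)
  have hq : Function.Surjective q := ε.surjective.comp (Submodule.mkQ_surjective _)
  refine ⟨φ.rep.asModuleEquiv.toLinearMap.comp
    ((q.restrictScalars (ResidueField O)).comp ρ.asModuleEquiv.symm.toLinearMap), ?_, fun g v => ?_⟩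
  · exact φ.rep.asModuleEquiv.surjective.comp (hq.comp ρ.asModuleEquiv.symm.surjective)
  · simp only [LinearMap.comp_apply, LinearEquiv.coe_coe, LinearMap.restrictScalars_apply]
    rw [Representation.asModuleEquiv_symm_map_rho, map_smul, Representation.asModuleEquiv_map_smul,
      Representation.asAlgebraHom_of]

/-- The index of `PK` divides both the `p`-power `|G : K|` and the prime-to-`p` number `|G : P|`. -/
theorem IsPComplement.exists_eq_mul {p : ℕ} [Fact p.Prime] {G : Type*} [Group G] [Finite G]
    {K : Subgroup G} [K.Normal] (hK : IsPComplement p K) (P : Sylow p G) (g : G) :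
    ∃ x ∈ (P : Subgroup G), ∃ k ∈ K, g = x * k := by
  obtain ⟨-, a, ha⟩ := hK
  have h1 : ((P : Subgroup G) ⊔ K).index ∣ p ^ a := ha ▸ Subgroup.index_dvd_of_le le_sup_right
  have h2 : ((P : Subgroup G) ⊔ K).index ∣ (P : Subgroup G).index :=
    Subgroup.index_dvd_of_le le_sup_left
  have h3 : Nat.Coprime (p ^ a) (P : Subgroup G).index :=
    Nat.Coprime.pow_left _ (((Fact.out : p.Prime).coprime_iff_not_dvd).2 P.not_dvd_index)
  have h4 : (P : Subgroup G) ⊔ K = ⊤ :=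
    Subgroup.index_eq_one.1 (Nat.eq_one_of_dvd_coprimes h3 h1 h2)
  obtain ⟨x, hx, k, hk, h⟩ := Subgroup.mem_sup_of_normal_right.1 (h4 ▸ Subgroup.mem_top g)
  exact ⟨x, hx, k, hk, h.symm⟩

/-- Normality removes the case distinction on `K`, and clearing the factor `|K|⁻¹` lets the formula
be read inside `O`. -/
theorem card_mul_inducedCharacter {G : Type*} [Group G] [Fintype G] (K : Subgroup G) [K.Normal]
    (χ : K → ℂ) (k : K) :
    (Nat.card K : ℂ) * inducedCharacter K χ k = ∑ x : G, χ (MulAut.conjNormal x⁻¹ k) := by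
  have h0 : (Nat.card K : ℂ) ≠ 0 := Nat.cast_ne_zero.2 Nat.card_pos.ne'
  rw [inducedCharacter, mul_inv_cancel_left₀ h0]
  refine Finset.sum_congr (by ext; simp) fun x _ => ?_
  have h : x⁻¹ * k * x ∈ K := by
    simpa using (inferInstance : K.Normal).conj_mem k k.2 x⁻¹
  rw [dif_pos h]
  congr 1
  ext
  simp

theorem mainTheorem6 (p : ℕ) [Fact p.Prime] (O : ValuationSubring ℂ)
    [CharP (IsLocalRing.ResidueField O) p] {G : Type*} [Group G] [Finite G]
    (P : Sylow p G) (K : Subgroup G) [K.Normal] (hK : IsPComplement p K)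
    (φ : IBr p O G) (χ : Irr K) (hχ : IsFongCharacter φ K χ) :
    φ.fixDegree (P : Subgroup G) = φ.degree / p ^ φ.degree.factorization p ↔
      ActsTriviallyOnQuotientKer (inertiaGroup K (P : Subgroup G) χ) K χ := by
  have : Fintype G := Fintype.ofFinite G
  have : Fintype K := Fintype.ofFinite K
  have : PerfectRing (ResidueField O) p := O.perfectRing_residueField p
  obtain ⟨d, Y, c, hd, hY, hYC, hχY⟩ := χ.exists_integral_rep O
  obtain ⟨n, X, -, hPIM, hX⟩ := hχ
  obtain ⟨π, hπsurj, hπ⟩ := hPIM.exists_surjective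
  have hcard : (Fintype.card K : ResidueField O) ≠ 0 := by
    rw [Ne, CharP.cast_eq_zero_iff (ResidueField O) p, ← Nat.card_eq_fintype_card]
    exact hK.1
  have hunit : IsUnit (Fintype.card K : O) := by
    rw [← IsLocalRing.residue_ne_zero_iff_isUnit, map_natCast]
    exact hcard
  have hcd := hY.mul_degree hd
  -- `c` divides the unit `|K|` because `c d = |K|`.
  obtain ⟨c, rfl⟩ : IsUnit c := isUnit_of_dvd_unit (Dvd.intro _ hcd) hunit
  set W : K →* Matrix (Fin d) (Fin d) (ResidueField O) := mapMatRep (residue O) Y with hWdef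
  have hW : SchurOrthogonal W (residue O c) := hY.map _ IsLocalRing.residue_surjective
  have hc0 : residue O c ≠ 0 := (IsLocalRing.residue_ne_zero_iff_isUnit _).2 c.isUnit
  have hpd : ¬ p ∣ d := by
    rw [← CharP.cast_eq_zero_iff (ResidueField O) p]
    intro h
    have := hW.mul_degree hd
    rw [h, mul_zero] at this
    exact hcard this.symm
  have htrW : ∀ k, (W k).trace = residue O (Y k).trace := fun k =>
    (AddMonoidHom.map_trace (residue O).toAddMonoidHom (Y k)).symm
  have htrYC : ∀ k, (mapMatRep O.subtype Y k).trace = χ k := fun k => by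
    rw [hχY]
    exact (AddMonoidHom.map_trace O.subtype.toAddMonoidHom (Y k)).symm
  have hdeg : φ.degree ≠ 0 := by
    intro h
    have h1 := nontrivial_of_isIrreducible φ.rep_isIrreducible
    rw [h] at h1
    exact not_subsingleton (Fin 0 → ResidueField O) inferInstance
  have hXY : ∀ k : K, (Fintype.card K : O) * (X k).trace
      = ∑ x : G, (Y (MulAut.conjNormal x⁻¹ k)).trace := by
    intro k
    apply Subtype.val_injective
    have := card_mul_inducedCharacter K χ k
    rw [hX, Nat.card_eq_fintype_card] at this
    push_cast
    rw [this]
    exact Finset.sum_congr rfl fun x _ => hχY _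
  have he := lift_centralIdempotent_ne_zero K hY X hXY φ.mat hdeg π hπsurj hπ
  have he' : ∑ k : K, (W k⁻¹).trace • φ.rep k ≠ 0 := by
    intro h
    apply he
    rw [lift_centralIdempotent]
    have h1 : ∑ k : K, (W k⁻¹).trace • φ.mat k = 0 := by
      apply (Matrix.toLinAlgEquiv' : Matrix (Fin φ.degree) (Fin φ.degree) (ResidueField O)
        ≃ₐ[ResidueField O] _).injective
      rw [map_sum, map_zero, ← h]
      exact Finset.sum_congr rfl fun k _ => map_smul _ _ _
    refine (congrArg _ (Eq.trans (Finset.sum_congr rfl fun k _ => ?_) h1)).trans (smul_zero _)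
    rw [htrW, ← algebraMap_smul (ResidueField O) (Y k⁻¹).trace]
    rfl
  obtain ⟨h1, h2⟩ := finrank_and_finrank_invariants_iff φ.rep_isIrreducible (P : Subgroup G)
    (inertiaGroup K (P : Subgroup G) χ) P.isPGroup' (fun x hx => hx.1) (hK.exists_eq_mul P)
    hW hc0 hd hcard (fun x hx k => by
      rw [htrW, htrW]
      congr 1
      apply Subtype.val_injective
      rw [← hχY, ← hχY, hx.2]) (fun x hxP hxI => by
      obtain ⟨k, hk⟩ : ∃ k, χ (MulAut.conjNormal x k) ≠ χ k := by
        by_contra! h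
        exact hxI ⟨hxP, h⟩
      have hcC : ((c : O) : ℂ) ≠ 0 := fun h => c.ne_zero (Subtype.ext h)
      -- For `x` outside the inertia group the two characters are known to differ only over `ℂ`. The
      -- vanishing of the block sum is therefore proved there, pulled back to `O`, and then reduced.
      have h3 := sum_trace_inv_smul_eq_zero (sum_conj_eq_zero_of_trace_ne
        (W := (mapMatRep O.subtype Y).comp (MulAut.conjNormal x⁻¹ : MulAut K).toMonoidHom)
        hYC hcC (k := MulAut.conjNormal x k) (by
          change (mapMatRep O.subtype Y (MulAut.conjNormal x⁻¹ (MulAut.conjNormal x k))).trace ≠ _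
          rw [htrYC, htrYC, ← MulAut.mul_apply, ← map_mul, inv_mul_cancel, map_one,
            MulAut.one_apply]
          exact hk.symm))
      have h4 : ∑ k, (Y k⁻¹).trace • Y (MulAut.conjNormal x⁻¹ k) = 0 := by
        apply Matrix.map_injective (f := O.subtype) Subtype.val_injective
        beta_reduce
        rw [map_sum_trace_inv_smul, Matrix.map_zero _ (map_zero _)]
        exact h3
      rw [hWdef, ← map_sum_trace_inv_smul, h4, Matrix.map_zero _ (map_zero _)]) he'
  rw [Module.finrank_fin_fun] at h1
  obtain ⟨b, hb⟩ := P.isPGroup'.index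
    ((inertiaGroup K (P : Subgroup G) χ).subgroupOf (P : Subgroup G))
  -- `φ(1) = |P : I| d`, where the index is a power of `p` and `p ∤ d`.
  have h3 : φ.degree / p ^ φ.degree.factorization p = d := by
    have h4 : φ.degree = p ^ b * d := by rw [h1, Subgroup.relIndex, hb]
    have hp : p.Prime := Fact.out
    rw [h4, Nat.factorization_mul (pow_ne_zero _ hp.ne_zero) hd, Finsupp.add_apply,
      hp.factorization_pow, Finsupp.single_eq_same, Nat.factorization_eq_zero_of_not_dvd hpd,
      add_zero, Nat.mul_div_cancel_left _ (pow_pos hp.pos _)]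
  rw [h3]
  refine h2.trans (forall₂_congr fun x _ => forall_congr' fun k => ?_)
  rw [QuotientGroup.eq]
  -- Both conditions on `x` and `k` say that this element is in a kernel, of `W` on one side and of
  -- `χ` on the other.
  set h := (MulAut.conjNormal x k)⁻¹ * k with hh
  have h5 : W (MulAut.conjNormal x k) = W k ↔ W h = 1 := by
    rw [hh, map_mul]
    constructor
    · intro hk
      rw [← hk, ← map_mul, inv_mul_cancel, map_one]
    · intro hk
      calc _ = W (MulAut.conjNormal x k) * (W (MulAut.conjNormal x k)⁻¹ * W k) := by rw [hk, mul_one]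
        _ = _ := by rw [← mul_assoc, ← map_mul, mul_inv_cancel, map_one, one_mul]
  have h6 : h ∈ χ.ker ↔ mapMatRep O.subtype Y h = 1 :=
    χ.apply_eq_apply_one_iff (fun k => (htrYC k).symm) h
  rw [h5, h6]
  have h7 : W h = 1 ↔ Y h = 1 :=
    ⟨fun hk => eq_one_of_residue_eq_one (Y h) hunit
        (by rw [← map_pow, pow_card_eq_one, map_one]) hk,
      fun hk => by rw [hWdef, mapMatRep_apply, hk, Matrix.map_one _ (map_zero _) (map_one _)]⟩
  have h8 : mapMatRep O.subtype Y h = 1 ↔ Y h = 1 :=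
    ⟨fun hk => Matrix.map_injective (f := O.subtype) Subtype.val_injective
        (hk.trans (Matrix.map_one _ (map_zero _) (map_one _)).symm),
      fun hk => by rw [mapMatRep_apply, hk, Matrix.map_one _ (map_zero _) (map_one _)]⟩
  rw [h7, h8]
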